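/- Let $d\ge 1$ be an integer and let $a,b>0$. For an integer $n\ge1$ let $\mathbb T_n^d=\mathbb Z^d/n\mathbb Z^d$, write $x\sim y$ if $|x_1-y_1|+\dots+|x_d-y_d|=1$ (with $|\cdot|$ the distance to $0$ in $\mathbb Z/n\mathbb Z$), and let $\Omega_n=\{0,1\}^{\mathbb T_n^d}$. For $\lambda>-a$ let $$c_x(\eta)=\Big(a+\frac{\lambda}{2d}\sum_{y\sim x}\eta_y\Big)(1-\eta_x)+b\,\eta_x ,$$ and consider the continuous-time Markov chain on $\Omega_n$ with generator $$L_nh(\eta)=n^2\sum_{\{x,y\}:\,x\sim y}\big(h(\eta^{x,y})-h(\eta)\big)+\sum_{x\in\mathbb T_n^d}c_x(\eta)\big(h(\eta^x)-h(\eta)\big),$$ where the first sum is over unordered pairs, $\eta^{x,y}$ is $\eta$ with the values at $x$ and $y$ exchanged, and $\eta^x$ is $\eta$ with the value at $x$ replaced by $1-\eta_x$. Put $g_d(n)=n$ if $d=1$, $g_d(n)=\log n$ if $d=2$, and $g_d(n)=1$ if $d\ge3$. Then there exist $\lambda_c=\lambda_c(a,b,d)\in(0,a)$ and a finite constant $C=C(a,b,d)$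 such that for every integer $n\ge 1$ (with $n\ge2$ if $d=2$) and every $\lambda\in[-\lambda_c,\lambda_c]$ the following holds. The function $F(\rho)=(a+\lambda\rho)(1-\rho)-b\rho$ has a unique zero $\rho_*$ in $[0,1]$, the chain has a unique invariant probability measure $\mu^n_{\mathrm{ss}}$, and for every continuous function $f:\mathbb T^d=\mathbb R^d/\mathbb Z^d\to\mathbb R$, $$\int\Big(\frac1{n^d}\sum_{x\in\mathbb T_n^d}(\eta_x-\rho_*)f\big(\tfrac xn\big)\Big)^2\mu^n_{\mathrm{ss}}(d\eta)\le\frac{C\,g_d(n)}{n^2}\cdot\frac1{n^d}\sum_{x\in\mathbb T_n^d}f\big(\tfrac xn\big)^2 .$$ -/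

import Mathlib

noncomputable section

namespace ReactionDiffusion

open MeasureTheory

/-- The discrete torus `ℤ^d / n ℤ^d`. -/
abbrev Torus (d n : ℕ) : Type := Fin d → ZMod n

/-- Particle configurations `{0,1}^{𝕋_n^d}`; `true` means that the site is occupied. -/
abbrev Config (d n : ℕ) : Type := Torus d n → Bool

variable {d n : ℕ}

/-- The occupation number `η_x ∈ {0,1}`, as a real number. -/
def occ (η : Config d n) (x : Torus d n) : ℝ := if η x then 1 else 0

/-- The configuration `η^{x,y}`, with the values at `x` and `y` exchanged. -/
def exchange (x y : Torus d n) (η : Config d n) : Config d n :=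
  fun z => if z = x then η y else if z = y then η x else η z

/-- The configuration `η^x`, with the value at `x` flipped. -/
def flip (x : Torus d n) (η : Config d n) : Config d n :=
  fun z => if z = x then !(η x) else η z

/-- Nearest neighbours: `|x_1 - y_1| + ⋯ + |x_d - y_d| = 1`, where `|·|` is the distance to `0`
in `ℤ / n ℤ`. -/
abbrev Adj (x y : Torus d n) : Prop := ∑ i, (x i - y i).valMinAbs.natAbs = 1

/-- The flip rate `c_x(η) = (a + λ/(2d) ∑_{y ∼ x} η_y) (1 - η_x) + b η_x`. -/
def rate [NeZero n] (a b lam : ℝ) (x : Torus d n) (η : Config d n) : ℝ :=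
  (a + lam / (2 * d) * ∑ y with Adj x y, occ η y) * (1 - occ η x) + b * occ η x

/-- The generator `L_n`, with exclusion accelerated by `n^2`. The sum over ordered pairs of
neighbours is halved, so that each unordered pair contributes once. -/
def generator [NeZero n] (a b lam : ℝ) : (Config d n → ℝ) →ₗ[ℝ] (Config d n → ℝ) where
  toFun h η :=
    (n : ℝ) ^ 2 * ((∑ x, ∑ y with Adj x y, (h (exchange x y η) - h η)) / 2)
      + ∑ x, rate a b lam x η * (h (flip x η) - h η)
  map_add' h k := by
    funext η
    have e : ∀ p q r s : ℝ, p + q - (r + s) = (p - r) + (q - s) := fun _ _ _ _ => by ring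
    simp only [Pi.add_apply, e, mul_add, Finset.sum_add_distrib]
    ring
  map_smul' c h := by
    funext η
    have e : ∀ p q : ℝ, c * p - c * q = c * (p - q) := fun _ _ => by ring
    have e' : ∀ p q : ℝ, p * (c * q) = c * (p * q) := fun _ _ => by ring
    simp only [Pi.smul_apply, smul_eq_mul, RingHom.id_apply, e, e', ← Finset.mul_sum]
    ring

/-- The Markov semigroup `P_t = exp(t L_n)` of the chain, acting on functions:
`P_t h (η) = E_η[h(η(t))]`. -/
def semigroup [NeZero n] (a b lam t : ℝ) : (Config d n → ℝ) →L[ℝ] (Config d n → ℝ) :=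
  NormedSpace.exp (t • LinearMap.toContinuousLinearMap (generator a b lam))

/-- `μ` is an invariant probability measure of the chain generated by `L_n`. -/
def IsInvariant [NeZero n] (a b lam : ℝ) (μ : Measure (Config d n)) : Prop :=
  IsProbabilityMeasure μ ∧
    ∀ t : ℝ, 0 ≤ t → ∀ h : Config d n → ℝ, ∫ η, semigroup a b lam t h η ∂μ = ∫ η, h η ∂μ

/-- The averaged reaction rate `F(ρ) = (a + λ ρ)(1 - ρ) - b ρ`. -/
def reaction (a b lam ρ : ℝ) : ℝ := (a + lam * ρ) * (1 - ρ) - b * ρ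

/-- `ρ` is a zero of `F` in `[0,1]`. -/
def IsStationaryDensity (a b lam ρ : ℝ) : Prop :=
  ρ ∈ Set.Icc (0 : ℝ) 1 ∧ reaction a b lam ρ = 0

/-- `g_d(n)`: `n` if `d = 1`, `log n` if `d = 2`, `1` if `d ≥ 3`. -/
def green (d n : ℕ) : ℝ := if d = 1 then (n : ℝ) else if d = 2 then Real.log n else 1

/-- The point `x / n` of the continuous torus `𝕋^d = ℝ^d / ℤ^d`. -/
def scaled [NeZero n] (x : Torus d n) : Fin d → UnitAddCircle := fun i => ZMod.toAddCircle (x i)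

end ReactionDiffusion

end

/-! Expanding the square, the diagonal contributes at most `n^{-d}` times the average of `f²`. By
Cauchy–Schwarz it remains to bound every two-point correlation by a constant times `g_d(n)/n²`. No
entropy estimate is needed: a maximum principle for the stationary correlations φ(A) = E ∏_{x∈A}
(η_x - ρ) does this.

Stationarity applied to these products (`generator_centred`) gives one equation per set `A`.
Exclusion moves `A` like a set of exclusion particles, and the reaction damps φ(A) at rate at least
`b|A|`, its constant term vanishing because F(ρ) = 0. The remaining terms carry a factor `λ` and
involve sets of other sizes, so the hierarchy does not close. The torus being finite, V = max |φ(A)|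
over nonempty `A` still bounds them all, except for a source of order `λ` on adjacent pairs, where
the square of a centred variable has a constant part.

When |A| ≠ 2 there is no source, and evaluating at a maximiser gives |φ(A)| ≤ (4/b)|λ|V. For pairs,
the source is absorbed by a multiple of the killed Green function `G`: suppressing the jump of one
particle onto the other costs `2n²(G(0) - G(z))`, which is bounded below uniformly in `n`
(`exchange_killedGreen_le`). Hence V ≤ K·G(0) + (4/b)|λ|V, and |λ| ≤ b/8 closes the bound
(`abs_correlation_le`). A Fourier sum over shells gives G(0) ≲ g_d(n)/n² (`killedGreen_zero_le`). -/

noncomputable section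

namespace ReactionDiffusion

open MeasureTheory Matrix

/-! ### Stationary vectors of finite Markov generators -/

section StationaryVectors

variable {ι : Type*} [Fintype ι] [DecidableEq ι] {Q : Matrix ι ι ℝ}

/-- If `Q` is a Markov generator matrix, the absolute value of a left null vector is again a left
null vector. -/
theorem abs_vecMul_eq_zero (hoff : ∀ i j, i ≠ j → 0 ≤ Q i j) (hrow : ∀ i, ∑ j, Q i j = 0)
    {v : ι → ℝ} (hv : v ᵥ* Q = 0) : (fun i => |v i|) ᵥ* Q = 0 := by
  have hdiag : ∀ j, Q j j ≤ 0 := fun j => by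
    have h := hrow j
    rw [← Finset.add_sum_erase _ _ (Finset.mem_univ j)] at h
    have : 0 ≤ ∑ k ∈ Finset.univ.erase j, Q j k :=
      Finset.sum_nonneg fun k hk => hoff j k (Finset.ne_of_mem_erase hk).symm
    linarith
  -- Isolate the nonpositive diagonal entry and use the triangle inequality. The row sums make these
  -- nonnegative quantities add up to zero, so each vanishes.
  have hnn : ∀ j, 0 ≤ ∑ i, |v i| * Q i j := fun j => by
    have h : ∑ i, v i * Q i j = 0 := congrFun hv j
    rw [← Finset.add_sum_erase _ _ (Finset.mem_univ j)] at h ⊢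
    have h1 : |∑ i ∈ Finset.univ.erase j, v i * Q i j|
        ≤ ∑ i ∈ Finset.univ.erase j, |v i| * Q i j := by
      refine (Finset.abs_sum_le_sum_abs _ _).trans (Finset.sum_le_sum fun i hi => ?_)
      rw [abs_mul, abs_of_nonneg (hoff i j (Finset.ne_of_mem_erase hi))]
    have h2 : |∑ i ∈ Finset.univ.erase j, v i * Q i j| = |v j| * (-Q j j) := by
      rw [eq_neg_of_add_eq_zero_right h, abs_neg, abs_mul, abs_of_nonpos (hdiag j)]
    linarith
  have hsum : ∑ j, ∑ i, |v i| * Q i j = 0 := by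
    rw [Finset.sum_comm]
    simp [← Finset.mul_sum, hrow]
  funext j
  exact (Finset.sum_eq_zero_iff_of_nonneg fun j _ => hnn j).1 hsum j (Finset.mem_univ j)

/-- Constants lie in the right kernel, so `Q` is singular and has a left null vector; normalise its
absolute value. -/
theorem exists_stationary_vector [Nonempty ι] (hoff : ∀ i j, i ≠ j → 0 ≤ Q i j)
    (hrow : ∀ i, ∑ j, Q i j = 0) :
    ∃ v : ι → ℝ, (∀ i, 0 ≤ v i) ∧ ∑ i, v i = 1 ∧ v ᵥ* Q = 0 := by
  have hdet : Q.det = 0 := Matrix.exists_mulVec_eq_zero_iff.1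
    ⟨1, one_ne_zero, by funext i; simpa [Matrix.mulVec, dotProduct] using hrow i⟩
  obtain ⟨v, hv0, hv⟩ := Matrix.exists_vecMul_eq_zero_iff.2 hdet
  have habs := abs_vecMul_eq_zero hoff hrow hv
  have hpos : 0 < ∑ i, |v i| := by
    obtain ⟨i, hi⟩ := Function.ne_iff.1 hv0
    exact Finset.sum_pos' (fun i _ => abs_nonneg _) ⟨i, Finset.mem_univ i, abs_pos.2 hi⟩
  refine ⟨(∑ i, |v i|)⁻¹ • fun i => |v i|, fun i => ?_, ?_, ?_⟩
  · exact mul_nonneg (inv_nonneg.2 hpos.le) (abs_nonneg _)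
  · simp [← Finset.mul_sum, inv_mul_cancel₀ hpos.ne']
  · rw [Matrix.smul_vecMul, habs, smul_zero]

/-- Irreducibility enters as `hirr`. Apply it to `|v| + v`, which vanishes wherever `v ≤ 0`: then `v
≤ 0` everywhere, and zero total mass forces `v = 0`. -/
theorem stationary_vector_eq_zero [Nonempty ι] (hoff : ∀ i j, i ≠ j → 0 ≤ Q i j)
    (hrow : ∀ i, ∑ j, Q i j = 0)
    (hirr : ∀ w : ι → ℝ, (∀ i, 0 ≤ w i) → w ᵥ* Q = 0 → (∃ i, w i = 0) → w = 0)
    {v : ι → ℝ} (hv : v ᵥ* Q = 0) (hsum : ∑ i, v i = 0) : v = 0 := by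
  have habs := abs_vecMul_eq_zero hoff hrow hv
  obtain ⟨i, hi⟩ : ∃ i, v i ≤ 0 := by
    by_contra! h
    exact (Finset.sum_pos (fun i _ => h i) Finset.univ_nonempty).ne' hsum
  have hw := hirr ((fun i => |v i|) + v) (fun i => by
      have := neg_abs_le (v i)
      simp only [Pi.add_apply]; linarith)
    (by rw [Matrix.add_vecMul, habs, hv, add_zero])
    ⟨i, by simp [abs_of_nonpos hi]⟩
  have hneg : ∀ j, v j ≤ 0 := fun j => by
    have h : |v j| + v j = 0 := congrFun hw j
    linarith [abs_nonneg (v j)]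
  funext j
  exact (Finset.sum_eq_zero_iff_of_nonpos fun j _ => hneg j).1 hsum j (Finset.mem_univ j)

end StationaryVectors

/-! ### Existence and uniqueness of the invariant measure -/

variable {d n : ℕ}

theorem occ_nonneg (η : Config d n) (x : Torus d n) : 0 ≤ occ η x := by
  unfold occ; split_ifs <;> norm_num

theorem occ_le_one (η : Config d n) (x : Torus d n) : occ η x ≤ 1 := by
  unfold occ; split_ifs <;> norm_num

theorem flip_flip (x : Torus d n) (η : Config d n) : flip x (flip x η) = η := by
  funext z
  by_cases h : z = x <;> simp [flip, h]

/-- A set of configurations closed under flips and non-empty is everything. -/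
theorem forall_of_flip [NeZero n] {p : Config d n → Prop} (hp : ∀ x η, p η → p (flip x η))
    {ζ : Config d n} (hζ : p ζ) (η : Config d n) : p η := by
  have key : ∀ s : Finset (Torus d n), p fun z => if z ∈ s then η z else ζ z := fun s => by
    induction s using Finset.induction_on with
    | empty => simpa using hζ
    | insert x s hx ih =>
      by_cases h : η x = ζ x
      · convert ih using 2 with z
        by_cases hz : z = x <;> simp [hz, hx, h]
      · convert hp x _ ih using 1
        funext z
        by_cases hz : z = x
        · subst hz
          simp only [Finset.mem_insert, true_or, if_true, flip, if_neg hx]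
          revert h
          cases η z <;> cases ζ z <;> simp
        · simp [hz, flip]
  simpa using key Finset.univ

variable [NeZero n]

theorem generator_apply (a b lam : ℝ) (h : Config d n → ℝ) (η : Config d n) :
    generator a b lam h η
      = (n : ℝ) ^ 2 * ((∑ x, ∑ y with Adj x y, (h (exchange x y η) - h η)) / 2)
        + ∑ x, rate a b lam x η * (h (flip x η) - h η) := rfl

theorem integral_config (μ : Measure (Config d n)) [IsFiniteMeasure μ] (h : Config d n → ℝ) :
    ∫ η, h η ∂μ = ∑ η, μ.real {η} * h η := by
  rw [integral_fintype .of_finite]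
  simp

/-- A probability measure is invariant if and only if it annihilates the range of the generator. -/
theorem isInvariant_iff (a b lam : ℝ) (μ : Measure (Config d n)) :
    IsInvariant a b lam μ ↔
      IsProbabilityMeasure μ ∧ ∀ h : Config d n → ℝ, ∫ η, generator a b lam h η ∂μ = 0 := by
  refine and_congr_right fun hμ => ?_
  let A : (Config d n → ℝ) →L[ℝ] (Config d n → ℝ) :=
    LinearMap.toContinuousLinearMap (generator a b lam)
  let ℓ : (Config d n → ℝ) →L[ℝ] ℝ := LinearMap.toContinuousLinearMap
    { toFun := fun h => ∑ η, μ.real {η} * h η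
      map_add' := fun h k => by simp [mul_add, Finset.sum_add_distrib]
      map_smul' := fun c h => by
        simp only [Pi.smul_apply, smul_eq_mul, RingHom.id_apply, Finset.mul_sum]
        exact Finset.sum_congr rfl fun _ _ => by ring }
  have hℓ : ∀ h : Config d n → ℝ, ∫ η, h η ∂μ = ℓ h := fun h => integral_config μ h
  have hderiv : ∀ (h : Config d n → ℝ) (t : ℝ),
      HasDerivAt (fun t => ℓ (semigroup a b lam t h)) (ℓ (A (semigroup a b lam t h))) t := by
    intro h t
    have h1 : HasDerivAt (fun t : ℝ => NormedSpace.exp (t • A)) (A * NormedSpace.exp (t • A)) t :=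
      hasDerivAt_exp_smul_const' A t
    have h2 : HasDerivAt (fun t : ℝ => NormedSpace.exp (t • A) h) (A (NormedSpace.exp (t • A) h)) t := by
      simpa using h1.clm_apply (hasDerivAt_const t h)
    exact ℓ.hasFDerivAt.comp_hasDerivAt t h2
  have h0 : ∀ h : Config d n → ℝ, semigroup a b lam 0 h = h := fun h => by
    simp [semigroup, NormedSpace.exp_zero]
  simp only [hℓ]
  constructor
  · intro hinv h
    -- Invariance is known only for `t ≥ 0`, so the derivative at `0` is taken one-sided.
    have h1 : HasDerivWithinAt (fun t => ℓ (semigroup a b lam t h)) (ℓ (A h)) (Set.Ici 0) 0 := by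
      simpa [h0] using (hderiv h 0).hasDerivWithinAt (s := Set.Ici 0)
    have h2 : HasDerivWithinAt (fun t => ℓ (semigroup a b lam t h)) 0 (Set.Ici 0) 0 :=
      (hasDerivWithinAt_const (0 : ℝ) (Set.Ici 0) (ℓ h)).congr (fun t ht => hinv t ht h)
        (hinv 0 le_rfl h)
    exact (uniqueDiffOn_Ici (0 : ℝ) 0 Set.self_mem_Ici).eq_deriv _ h1 h2
  · intro hgen t _ h
    have hc := is_const_of_deriv_eq_zero (fun t => (hderiv h t).differentiableAt)
      (fun t => (hderiv h t).deriv.trans (hgen _)) t 0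
    simpa [h0] using hc

theorem toMatrix_generator_apply (a b lam : ℝ) (η ζ : Config d n) :
    LinearMap.toMatrix' (generator a b lam) η ζ
      = generator a b lam (Pi.single ζ 1) η := by
  rw [LinearMap.toMatrix'_apply]

theorem vecMul_toMatrix_generator_iff (a b lam : ℝ) (v : Config d n → ℝ) :
    v ᵥ* LinearMap.toMatrix' (generator a b lam) = 0 ↔
      ∀ h : Config d n → ℝ, ∑ η, v η * generator a b lam h η = 0 := by
  have key : ∀ h : Config d n → ℝ, ∑ η, v η * generator a b lam h η
      = (v ᵥ* LinearMap.toMatrix' (generator a b lam)) ⬝ᵥ h := fun h => by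
    rw [← Matrix.dotProduct_mulVec, LinearMap.toMatrix'_mulVec]; rfl
  simp only [key]
  exact ⟨fun h k => by rw [h, zero_dotProduct], fun h => dotProduct_eq_zero _ h⟩

/-- If all flip rates are positive, the chain has exactly one invariant probability measure. -/
theorem existsUnique_isInvariant (a b lam : ℝ)
    (hrate : ∀ (x : Torus d n) (η : Config d n), 0 < rate a b lam x η) :
    ∃! μ : Measure (Config d n), IsInvariant a b lam μ := by
  set Q := LinearMap.toMatrix' (generator (d := d) (n := n) a b lam) with hQ
  have hsingle : ∀ ζ ξ : Config d n, (0 : ℝ) ≤ (Pi.single ζ 1 : Config d n → ℝ) ξ := fun ζ ξ => by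
    rw [Pi.single_apply]; split_ifs <;> norm_num
  have hoff : ∀ η ζ, η ≠ ζ → 0 ≤ Q η ζ := fun η ζ hne => by
    rw [hQ, toMatrix_generator_apply, generator_apply, Pi.single_eq_of_ne hne]
    simp only [sub_zero]
    refine add_nonneg (mul_nonneg (sq_nonneg _) (div_nonneg ?_ zero_le_two)) ?_
    · exact Finset.sum_nonneg fun x _ => Finset.sum_nonneg fun y _ => hsingle _ _
    · exact Finset.sum_nonneg fun x _ => mul_nonneg (hrate x η).le (hsingle _ _)
  have hpos : ∀ (x : Torus d n) (ζ : Config d n), 0 < Q (flip x ζ) ζ := fun x ζ => by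
    have hne : flip x ζ ≠ ζ := fun h => by
      have := congrFun h x
      simp [flip] at this
    rw [hQ, toMatrix_generator_apply, generator_apply, Pi.single_eq_of_ne hne]
    simp only [sub_zero]
    refine add_pos_of_nonneg_of_pos (mul_nonneg (sq_nonneg _) (div_nonneg ?_ zero_le_two)) ?_
    · exact Finset.sum_nonneg fun x _ => Finset.sum_nonneg fun y _ => hsingle _ _
    · refine Finset.sum_pos' (fun y _ => mul_nonneg (hrate y _).le (hsingle _ _))
        ⟨x, Finset.mem_univ x, ?_⟩
      rw [flip_flip, Pi.single_eq_same, mul_one]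
      exact hrate x _
  have hrow : ∀ η, ∑ ζ, Q η ζ = 0 := fun η => by
    have h1 : Q *ᵥ 1 = 0 := by
      rw [hQ, LinearMap.toMatrix'_mulVec]
      funext η
      simp [generator_apply]
    simpa [Matrix.mulVec, dotProduct] using congrFun h1 η
  -- A zero of `w` at `ξ` makes column `ξ` of `w ᵥ* Q = 0` a sum of nonnegative terms, so `w` also
  -- vanishes at every flip of `ξ`; flips alone connect all configurations.
  have hirr : ∀ w : Config d n → ℝ, (∀ η, 0 ≤ w η) → w ᵥ* Q = 0 → (∃ η, w η = 0) → w = 0 := by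
    rintro w hw hwQ ⟨ζ, hζ⟩
    funext η
    refine forall_of_flip (p := fun ξ => w ξ = 0) (fun x ξ hξ => ?_) hζ η
    have hsum : ∑ σ, w σ * Q σ ξ = 0 := congrFun hwQ ξ
    have hterm : ∀ σ ∈ Finset.univ, 0 ≤ w σ * Q σ ξ := fun σ _ => by
      by_cases hσ : σ = ξ
      · rw [hσ, hξ, zero_mul]
      · exact mul_nonneg (hw σ) (hoff σ ξ hσ)
    have := (Finset.sum_eq_zero_iff_of_nonneg hterm).1 hsum (flip x ξ) (Finset.mem_univ _)
    exact (mul_eq_zero.1 this).resolve_right (hpos x ξ).ne'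
  obtain ⟨v, hv0, hv1, hvQ⟩ := exists_stationary_vector hoff hrow
  have hlaw : ∀ μ : Measure (Config d n), IsInvariant a b lam μ → ∀ η, μ.real {η} = v η := by
    intro μ hμ
    obtain ⟨hp, hμ⟩ := (isInvariant_iff a b lam μ).1 hμ
    have h1 : (fun η => μ.real {η}) ᵥ* Q = 0 :=
      (vecMul_toMatrix_generator_iff a b lam _).2 fun h => by rw [← integral_config]; exact hμ h
    have h2 : ∑ η, μ.real {η} = 1 := by simp
    have h3 := stationary_vector_eq_zero hoff hrow hirr
      (v := (fun η => μ.real {η}) - v) (by rw [Matrix.sub_vecMul, h1, hvQ, sub_zero])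
      (by simp [h2, hv1])
    exact fun η => sub_eq_zero.1 (congrFun h3 η)
  let μ : Measure (Config d n) := ∑ η, ENNReal.ofReal (v η) • Measure.dirac η
  have hμs : ∀ η, μ {η} = ENNReal.ofReal (v η) := fun η => by
    simp [μ, Measure.finsetSum_apply, Set.indicator_apply]
  have hprob : IsProbabilityMeasure μ := ⟨by
    simp [μ, Measure.finsetSum_apply, ← ENNReal.ofReal_sum_of_nonneg fun η _ => hv0 η, hv1]⟩
  refine ⟨μ, (isInvariant_iff a b lam μ).2 ⟨hprob, fun h => ?_⟩, fun ν hν => ?_⟩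
  · rw [integral_config]
    simp only [Measure.real, hμs, ENNReal.toReal_ofReal (hv0 _)]
    exact (vecMul_toMatrix_generator_iff a b lam v).1 hvQ h
  · have := hν.1
    refine Measure.ext_of_singleton fun η => ?_
    rw [hμs, ← hlaw ν hν η, Measure.real, ENNReal.ofReal_toReal (measure_ne_top _ _)]

end ReactionDiffusion

end

noncomputable section

namespace ReactionDiffusion

/-! ### Lattice neighbours and positivity of the rates -/

section Neighbours

variable {d n : ℕ}

theorem adj_symm {x y : Torus d n} (h : Adj x y) : Adj y x := by
  unfold Adj at h ⊢
  rw [← h]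
  refine Finset.sum_congr rfl fun i _ => ?_
  rw [← neg_sub, ZMod.natAbs_valMinAbs_neg]

theorem Adj.ne {x y : Torus d n} (h : Adj x y) : x ≠ y := by
  rintro rfl
  simp [Adj] at h

/-- The sites `x + e_i` and `x - e_i`. -/
def step (x : Torus d n) (p : Fin d × Bool) : Torus d n :=
  x + Pi.single p.1 (if p.2 then 1 else -1)

theorem exists_step_of_adj {x y : Torus d n} (h : Adj x y) : ∃ p, step x p = y := by
  unfold Adj at h
  obtain ⟨i, hi⟩ : ∃ i, (x i - y i).valMinAbs.natAbs ≠ 0 := by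
    by_contra! h0
    simp [h0] at h
  rw [← Finset.add_sum_erase _ _ (Finset.mem_univ i)] at h
  have h1 : (x i - y i).valMinAbs.natAbs = 1 := by omega
  have h2 : ∑ j ∈ Finset.univ.erase i, (x j - y j).valMinAbs.natAbs = 0 := by omega
  have h3 : ∀ j, j ≠ i → x j = y j := fun j hj => by
    have := Finset.sum_eq_zero_iff.1 h2 j (Finset.mem_erase.2 ⟨hj, Finset.mem_univ j⟩)
    rw [Int.natAbs_eq_zero, ZMod.valMinAbs_eq_zero] at this
    exact sub_eq_zero.1 this
  have h4 : x i - y i = 1 ∨ x i - y i = -1 := by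
    rw [← ZMod.coe_valMinAbs (x i - y i)]
    rcases Int.natAbs_eq (x i - y i).valMinAbs with h | h <;> rw [h, h1] <;> simp
  rcases h4 with h4 | h4
  · refine ⟨(i, false), funext fun j => ?_⟩
    by_cases hj : j = i
    · subst hj; simp [step, ← h4]
    · simp [step, hj, h3 j hj]
  · refine ⟨(i, true), funext fun j => ?_⟩
    by_cases hj : j = i
    · subst hj
      have : (1 : ZMod n) = y j - x j := by rw [← neg_sub, h4, neg_neg]
      simp [step, this]
    · simp [step, hj, h3 j hj]

theorem natAbs_valMinAbs_one (hn : 3 ≤ n) : (1 : ZMod n).valMinAbs.natAbs = 1 := by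
  have h := ZMod.valMinAbs_natCast_of_le_half (n := n) (a := 1) (by omega)
  rw [Nat.cast_one] at h
  simp [h]

theorem adj_step (hn : 3 ≤ n) (x : Torus d n) (p : Fin d × Bool) : Adj x (step x p) := by
  obtain ⟨i, s⟩ := p
  unfold Adj
  rw [Finset.sum_eq_single i]
  · cases s <;> simp [step, natAbs_valMinAbs_one hn, ZMod.natAbs_valMinAbs_neg]
  · intro j _ hj
    simp [step, hj]
  · simp

/-- For `n ≤ 2` the residues `1` and `-1` coincide and opposite steps collide; this is why small
tori are treated apart. -/
theorem step_injective (hn : 3 ≤ n) (x : Torus d n) : Function.Injective (step x) := by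
  have h1 : (1 : ZMod n) ≠ 0 := fun h => by simpa [h] using natAbs_valMinAbs_one hn
  have h2 : (1 : ZMod n) ≠ -1 := fun h => by
    have h0 : ((2 : ℕ) : ZMod n) = 0 := by
      rw [Nat.cast_ofNat, ← one_add_one_eq_two]
      nth_rewrite 2 [h]
      exact add_neg_cancel 1
    have := Nat.le_of_dvd two_pos ((ZMod.natCast_eq_zero_iff 2 n).1 h0)
    omega
  rintro ⟨i, s⟩ ⟨j, t⟩ h
  have h' : (Pi.single i (if s then 1 else -1) : Torus d n) = Pi.single j (if t then 1 else -1) :=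
    add_left_cancel h
  have hij : i = j := by
    by_contra hij
    have := congrFun h' i
    rw [Pi.single_eq_same, Pi.single_eq_of_ne hij] at this
    cases s <;> simp [h1] at this
  subst hij
  have := congrFun h' i
  rw [Pi.single_eq_same, Pi.single_eq_same] at this
  cases s <;> cases t <;> simp_all [h2.symm]

variable [NeZero n]

theorem card_neighbours_le (x : Torus d n) :
    (Finset.univ.filter fun y => Adj x y).card ≤ 2 * d := by
  have h : (Finset.univ.filter fun y => Adj x y) ⊆ Finset.univ.image (step x) := fun y hy => by
    obtain ⟨p, hp⟩ := exists_step_of_adj (Finset.mem_filter.1 hy).2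
    exact Finset.mem_image.2 ⟨p, Finset.mem_univ p, hp⟩
  refine (Finset.card_le_card h).trans (Finset.card_image_le.trans ?_)
  simp [Fintype.card_prod, mul_comm]

/-- Having at most `2d` neighbours suffices, so this also covers `n ≤ 2`. -/
theorem rate_pos {a b lam : ℝ} (hb : 0 < b) (hlam : |lam| < a) (x : Torus d n)
    (η : Config d n) : 0 < rate a b lam x η := by
  have ha : 0 < a := (abs_nonneg _).trans_lt hlam
  have hs0 : 0 ≤ ∑ y with Adj x y, occ η y := Finset.sum_nonneg fun y _ => occ_nonneg η y
  have hs1 : ∑ y with Adj x y, occ η y ≤ 2 * d := by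
    refine (Finset.sum_le_card_nsmul _ _ 1 fun y _ => occ_le_one η y).trans ?_
    simpa using (Nat.cast_le (α := ℝ)).2 (card_neighbours_le x)
  have hm : |lam / (2 * d) * ∑ y with Adj x y, occ η y| ≤ |lam| := by
    rw [div_mul_eq_mul_div, abs_div, abs_mul, abs_of_nonneg hs0,
      abs_of_nonneg (by positivity : (0 : ℝ) ≤ 2 * d)]
    refine div_le_of_le_mul₀ (by positivity) (abs_nonneg _) ?_
    exact mul_le_mul_of_nonneg_left hs1 (abs_nonneg _)
  have hpos : 0 < a + lam / (2 * d) * ∑ y with Adj x y, occ η y := by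
    linarith [neg_le_of_abs_le hm]
  unfold rate
  by_cases h : η x
  · simpa [occ, h] using hb
  · simpa [occ, h] using hpos

theorem sum_neighbours (hn : 3 ≤ n) (x : Torus d n) (F : Torus d n → ℝ) :
    ∑ y with Adj x y, F y = ∑ i, (F (x + Pi.single i 1) + F (x - Pi.single i 1)) := by
  have h : (Finset.univ.filter fun y => Adj x y) = Finset.univ.image (step x) := by
    ext y
    simp only [Finset.mem_filter, Finset.mem_univ, true_and, Finset.mem_image]
    exact ⟨exists_step_of_adj, fun ⟨p, hp⟩ => hp ▸ adj_step hn x p⟩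
  rw [h, Finset.sum_image fun p _ q _ hpq => step_injective hn x hpq, Fintype.sum_prod_type]
  refine Finset.sum_congr rfl fun i _ => ?_
  simp [step, Pi.single_neg, sub_eq_add_neg]

theorem sum_neighbours_const (hn : 3 ≤ n) (x : Torus d n) (c : ℝ) :
    ∑ y with Adj x y, c = 2 * d * c := by
  rw [sum_neighbours hn]
  simp
  ring

end Neighbours

/-! ### The killed Green function -/

section Fourier

variable {d n : ℕ} [NeZero n]

/-- The real Fourier mode `cos (2π k · z / n)`. -/
def mode (k z : Torus d n) : ℝ := (ZMod.stdAddChar (∑ i, k i * z i)).re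

/-- The symbol of minus the discrete Laplacian. -/
def symbol (k : Torus d n) : ℝ := ∑ i, 2 * (1 - (ZMod.stdAddChar (k i)).re)

theorem re_stdAddChar_le_one (t : ZMod n) : (ZMod.stdAddChar t).re ≤ 1 :=
  (Complex.re_le_norm _).trans (Circle.norm_coe (ZMod.toCircle t)).le

theorem abs_re_stdAddChar_le_one (t : ZMod n) : |(ZMod.stdAddChar t).re| ≤ 1 :=
  (Complex.abs_re_le_norm _).trans (Circle.norm_coe (ZMod.toCircle t)).le

theorem stdAddChar_neg (t : ZMod n) :
    ZMod.stdAddChar (-t) = (starRingEnd ℂ) (ZMod.stdAddChar t) := by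
  simp [ZMod.stdAddChar_apply, AddChar.map_neg_eq_inv, ← Circle.coe_inv_eq_conj]

@[simp] theorem mode_zero (k : Torus d n) : mode k 0 = 1 := by
  simp [mode]

theorem mode_neg (k z : Torus d n) : mode k (-z) = mode k z := by
  simp [mode, stdAddChar_neg]

theorem mode_le_one (k z : Torus d n) : mode k z ≤ 1 := re_stdAddChar_le_one _

theorem abs_mode_le_one (k z : Torus d n) : |mode k z| ≤ 1 := abs_re_stdAddChar_le_one _

theorem symbol_nonneg (k : Torus d n) : 0 ≤ symbol k :=
  Finset.sum_nonneg fun i _ => by linarith [re_stdAddChar_le_one (k i)]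

theorem symbol_le (k : Torus d n) : symbol k ≤ 4 * d := by
  refine (Finset.sum_le_card_nsmul _ _ 4 fun i _ => ?_).trans (by simp [mul_comm])
  linarith [neg_le_of_abs_le (abs_re_stdAddChar_le_one (k i))]

theorem mode_step (k z : Torus d n) (i : Fin d) :
    mode k (z + Pi.single i 1) + mode k (z - Pi.single i 1)
      = 2 * (ZMod.stdAddChar (k i)).re * mode k z := by
  have h1 : ∑ j, k j * (z + Pi.single i 1 : Torus d n) j = ∑ j, k j * z j + k i := by
    simp [mul_add, Finset.sum_add_distrib, Pi.single_apply]
  have h2 : ∑ j, k j * (z - Pi.single i 1 : Torus d n) j = ∑ j, k j * z j + -k i := by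
    simp [mul_sub, Finset.sum_sub_distrib, Pi.single_apply]
    ring
  unfold mode
  rw [h1, h2, AddChar.map_add_eq_mul, AddChar.map_add_eq_mul, stdAddChar_neg]
  simp only [Complex.mul_re, Complex.conj_re, Complex.conj_im]
  ring

/-- Fourier modes are eigenfunctions of the discrete Laplacian. -/
theorem laplacian_mode (hn : 3 ≤ n) (k z : Torus d n) :
    ∑ y with Adj z y, (mode k y - mode k z) = -symbol k * mode k z := by
  rw [sum_neighbours hn, symbol, ← Finset.sum_neg_distrib, Finset.sum_mul]
  refine Finset.sum_congr rfl fun i _ => ?_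
  linarith [mode_step k z i]

theorem sum_mode {z : Torus d n} (hz : z ≠ 0) : ∑ k, mode k z = 0 := by
  let ψ : AddChar (Torus d n) ℂ :=
    { toFun := fun k => ZMod.stdAddChar (∑ i, k i * z i)
      map_zero_eq_one' := by simp
      map_add_eq_mul' := fun k l => by
        simp [add_mul, Finset.sum_add_distrib, AddChar.map_add_eq_mul] }
  have hψ : ψ ≠ 0 := fun h => by
    obtain ⟨i, hi⟩ := Function.ne_iff.1 hz
    have h1 : ψ (Pi.single i 1) = 1 := by rw [h]; rfl
    have h2 : ZMod.stdAddChar (z i) = (1 : ℂ) := by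
      rw [← h1]
      change _ = ZMod.stdAddChar (∑ j, (Pi.single i 1 : Torus d n) j * z j)
      simp [Pi.single_apply]
    exact hi (ZMod.injective_stdAddChar (h2.trans (AddChar.map_zero_eq_one _).symm))
  have h := congrArg Complex.re (AddChar.sum_eq_zero_iff_ne_zero.2 hψ)
  rw [Complex.re_sum] at h
  exact h

/-- The Green function at distance `z` of a random walk of rate `2 n^2`, killed at rate `1`. -/
def killedGreen (z : Torus d n) : ℝ :=
  ((n : ℝ) ^ d)⁻¹ * ∑ k, mode k z / (1 + 2 * (n : ℝ) ^ 2 * symbol k)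

theorem one_le_killed_symbol (k : Torus d n) : 1 ≤ 1 + 2 * (n : ℝ) ^ 2 * symbol k :=
  le_add_of_nonneg_right (mul_nonneg (by positivity) (symbol_nonneg k))

theorem killedGreen_neg (z : Torus d n) : killedGreen (-z) = killedGreen z := by
  simp [killedGreen, mode_neg]

theorem abs_killedGreen_le (z : Torus d n) : |killedGreen z| ≤ killedGreen (0 : Torus d n) := by
  unfold killedGreen
  rw [abs_mul, abs_of_nonneg (by positivity : 0 ≤ ((n : ℝ) ^ d)⁻¹)]
  refine mul_le_mul_of_nonneg_left ((Finset.abs_sum_le_sum_abs _ _).trans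
    (Finset.sum_le_sum fun k _ => ?_)) (by positivity)
  have := one_le_killed_symbol k
  rw [abs_div, abs_of_pos (by linarith : 0 < 1 + 2 * (n : ℝ) ^ 2 * symbol k), mode_zero]
  exact div_le_div_of_nonneg_right (abs_mode_le_one k z) (by linarith)

theorem killedGreen_zero_nonneg : 0 ≤ killedGreen (0 : Torus d n) :=
  (abs_nonneg _).trans (abs_killedGreen_le 0)

/-- Mode by mode the denominator cancels, leaving a multiple of `∑ k, mode k z`, a point mass at the
origin. -/
theorem laplacian_killedGreen (hn : 3 ≤ n) {z : Torus d n} (hz : z ≠ 0) :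
    2 * (n : ℝ) ^ 2 * ∑ y with Adj z y, (killedGreen y - killedGreen z) = killedGreen z := by
  have h1 : ∑ y with Adj z y, (killedGreen y - killedGreen z)
      = ((n : ℝ) ^ d)⁻¹ * ∑ k, -symbol k * mode k z / (1 + 2 * (n : ℝ) ^ 2 * symbol k) := by
    simp only [killedGreen, ← mul_sub, ← Finset.sum_sub_distrib, ← sub_div, ← Finset.mul_sum]
    rw [Finset.sum_comm]
    simp only [← Finset.sum_div, laplacian_mode hn]
  rw [h1, ← sub_eq_zero, killedGreen, mul_left_comm, ← mul_sub, Finset.mul_sum,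
    ← Finset.sum_sub_distrib]
  have h2 : ∀ k : Torus d n, 2 * (n : ℝ) ^ 2 *
      (-symbol k * mode k z / (1 + 2 * (n : ℝ) ^ 2 * symbol k))
        - mode k z / (1 + 2 * (n : ℝ) ^ 2 * symbol k) = -mode k z := fun k => by
    have := one_le_killed_symbol k
    field_simp
    ring
  rw [Finset.sum_congr rfl fun k _ => h2 k, Finset.sum_neg_distrib, sum_mode hz, neg_zero, mul_zero]

/-- All terms `1 - mode k z` are nonnegative and sum to `n^d`, while `symbol k ≤ 4d` bounds the
denominators. -/
theorem killedGreen_zero_sub_ge {z : Torus d n} (hz : z ≠ 0) :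
    1 / (1 + 8 * d * (n : ℝ) ^ 2) ≤ killedGreen (0 : Torus d n) - killedGreen z := by
  have hcard : ∑ k : Torus d n, (1 - mode k z) = (n : ℝ) ^ d := by
    rw [Finset.sum_sub_distrib, sum_mode hz]
    simp [ZMod.card]
  have hn : 0 < (n : ℝ) ^ d := pow_pos (Nat.cast_pos.2 (NeZero.pos n)) d
  have h : ∑ k : Torus d n, (1 - mode k z) / (1 + 8 * d * (n : ℝ) ^ 2)
      ≤ ∑ k : Torus d n, (1 - mode k z) / (1 + 2 * (n : ℝ) ^ 2 * symbol k) := by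
    refine Finset.sum_le_sum fun k _ => ?_
    have := one_le_killed_symbol k
    refine div_le_div_of_nonneg_left (by linarith [mode_le_one k z]) (by linarith) ?_
    nlinarith [symbol_le k, sq_nonneg (n : ℝ)]
  rw [← Finset.sum_div, hcard] at h
  unfold killedGreen
  rw [← mul_sub, ← Finset.sum_sub_distrib]
  simp only [mode_zero, ← sub_div]
  calc 1 / (1 + 8 * d * (n : ℝ) ^ 2)
      = ((n : ℝ) ^ d)⁻¹ * ((n : ℝ) ^ d / (1 + 8 * d * (n : ℝ) ^ 2)) := by field_simp
    _ ≤ _ := mul_le_mul_of_nonneg_left h (by positivity)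

/-- The sup norm of the representative of `k` closest to the origin. -/
def supAbs (k : Torus d n) : ℕ := Finset.univ.sup fun i => (k i).valMinAbs.natAbs

theorem supAbs_le (k : Torus d n) : supAbs k ≤ n :=
  Finset.sup_le fun i _ => (ZMod.natAbs_valMinAbs_le (k i)).trans (Nat.div_le_self n 2)

/-- This is `cos x ≤ 1 - 2x²/π²` on `[-π, π]`, at `x = 2πv/n` with `|v| ≤ n/2`. -/
theorem sq_valMinAbs_le (t : ZMod n) :
    8 * (t.valMinAbs.natAbs : ℝ) ^ 2 ≤ (n : ℝ) ^ 2 * (1 - (ZMod.stdAddChar t).re) := by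
  have hn : 0 < (n : ℝ) := Nat.cast_pos.2 (NeZero.pos n)
  set v := t.valMinAbs with hv
  have hre : (ZMod.stdAddChar t).re = Real.cos (2 * Real.pi * v / n) := by
    conv_lhs => rw [← ZMod.coe_valMinAbs t, ZMod.stdAddChar_coe]
    rw [← hv, ← Complex.exp_ofReal_mul_I_re]
    congr 2
    push_cast
    ring
  have habs : |(v : ℝ)| * 2 ≤ n := by
    have h1 := ZMod.natAbs_valMinAbs_le t
    have h2 : v.natAbs * 2 ≤ n := by omega
    rw [← Int.cast_abs, ← Nat.cast_natAbs]
    exact_mod_cast h2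
  have hx : |2 * Real.pi * v / n| ≤ Real.pi := by
    rw [abs_div, abs_mul, abs_of_pos hn, abs_of_pos Real.two_pi_pos, div_le_iff₀ hn]
    nlinarith [Real.pi_pos]
  have hcos := Real.cos_le_one_sub_mul_cos_sq hx
  have hsq : ((v.natAbs : ℕ) : ℝ) ^ 2 = (v : ℝ) ^ 2 := by
    rw [Nat.cast_natAbs, Int.cast_abs, sq_abs]
  rw [hre, hsq]
  have h3 : 2 / Real.pi ^ 2 * (2 * Real.pi * v / n) ^ 2 = 8 * (v : ℝ) ^ 2 / (n : ℝ) ^ 2 := by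
    have := Real.pi_ne_zero
    field_simp
    ring
  rw [h3] at hcos
  calc 8 * (v : ℝ) ^ 2 = (n : ℝ) ^ 2 * (8 * (v : ℝ) ^ 2 / (n : ℝ) ^ 2) := by field_simp
    _ ≤ _ := mul_le_mul_of_nonneg_left (by linarith) (by positivity)

theorem sq_supAbs_le (k : Torus d n) :
    (supAbs k : ℝ) ^ 2 ≤ 2 * (n : ℝ) ^ 2 * symbol k := by
  have key : ∀ i, ((k i).valMinAbs.natAbs : ℝ) ^ 2 ≤ 2 * (n : ℝ) ^ 2 * symbol k := fun i => by
    have h1 : 2 * (1 - (ZMod.stdAddChar (k i)).re) ≤ symbol k :=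
      Finset.single_le_sum (f := fun i => 2 * (1 - (ZMod.stdAddChar (k i)).re))
        (fun i _ => by linarith [re_stdAddChar_le_one (k i)]) (Finset.mem_univ i)
    have h2 := sq_valMinAbs_le (k i)
    have h3 := mul_le_mul_of_nonneg_left h1 (by positivity : 0 ≤ 2 * (n : ℝ) ^ 2)
    nlinarith [sq_nonneg ((k i).valMinAbs.natAbs : ℝ)]
  rcases isEmpty_or_nonempty (Fin d) with h | h
  · simp [supAbs, symbol]
  · obtain ⟨i, -, hi⟩ := Finset.exists_mem_eq_sup Finset.univ Finset.univ_nonempty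
      fun i => (k i).valMinAbs.natAbs
    rw [supAbs, hi]
    exact key i

theorem card_supAbs_le (j : ℕ) :
    (Finset.univ.filter fun k : Torus d n => supAbs k ≤ j).card ≤ (2 * j + 1) ^ d := by
  have h1 : (Finset.univ.filter fun k : Torus d n => supAbs k ≤ j)
      = Fintype.piFinset fun _ => Finset.univ.filter fun t : ZMod n => t.valMinAbs.natAbs ≤ j := by
    ext k
    simp [supAbs, Finset.sup_le_iff]
  have h2 : (Finset.univ.filter fun t : ZMod n => t.valMinAbs.natAbs ≤ j).card ≤ 2 * j + 1 := by
    have : (Finset.univ.filter fun t : ZMod n => t.valMinAbs.natAbs ≤ j).card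
        ≤ (Finset.Icc (-j : ℤ) j).card :=
      Finset.card_le_card_of_injOn ZMod.valMinAbs (fun t ht => by
        have := (Finset.mem_filter.1 ht).2
        simp only [Finset.coe_Icc, Set.mem_Icc]
        omega) (fun s _ t _ h => ZMod.injective_valMinAbs h)
    rw [Int.card_Icc] at this
    omega
  rw [h1, Fintype.card_piFinset]
  simpa using Nat.pow_le_pow_left h2 d

/-- Abel summation: after summing over `k`, only cardinalities of sup-norm boxes are needed. -/
theorem inv_one_add_sq_eq_sum {m N : ℕ} (h : m ≤ N) :
    1 / (1 + (m : ℝ) ^ 2) = (∑ j ∈ Finset.range N, if m ≤ j then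
      (1 / (1 + (j : ℝ) ^ 2) - 1 / (1 + ((j : ℝ) + 1) ^ 2)) else 0) + 1 / (1 + (N : ℝ) ^ 2) := by
  induction N, h using Nat.le_induction with
  | base =>
    rw [Finset.sum_eq_zero, zero_add]
    intro j hj
    rw [if_neg (by simpa using hj)]
  | succ N hN ih =>
    rw [Finset.sum_range_succ, if_pos hN, ih]
    push_cast
    ring

theorem inv_one_add_sq_sub_le (j : ℕ) :
    1 / (1 + (j : ℝ) ^ 2) - 1 / (1 + ((j : ℝ) + 1) ^ 2) ≤ 4 / ((j : ℝ) + 1) ^ 3 := by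
  have hj : (0 : ℝ) ≤ j := Nat.cast_nonneg j
  rw [div_sub_div _ _ (by positivity) (by positivity), div_le_div_iff₀ (by positivity) (by positivity)]
  nlinarith [pow_nonneg hj 2, pow_nonneg hj 3, pow_nonneg hj 4]

/-- The sum of `1 / (1 + |k|²)` over the torus, estimated by summation over sup-norm shells. -/
theorem sum_inv_one_add_sq_supAbs_le :
    ∑ k : Torus d n, 1 / (1 + (supAbs k : ℝ) ^ 2)
      ≤ 4 * 2 ^ d * ∑ j ∈ Finset.range n, ((j : ℝ) + 1) ^ d / ((j : ℝ) + 1) ^ 3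
        + (n : ℝ) ^ d / (n : ℝ) ^ 2 := by
  have hn : 0 < (n : ℝ) := Nat.cast_pos.2 (NeZero.pos n)
  rw [Finset.sum_congr rfl fun k _ => inv_one_add_sq_eq_sum (supAbs_le k), Finset.sum_add_distrib,
    Finset.sum_comm]
  refine add_le_add ?_ ?_
  · rw [Finset.mul_sum]
    refine Finset.sum_le_sum fun j _ => ?_
    rw [← Finset.sum_filter, Finset.sum_const, nsmul_eq_mul]
    have h1 : ((Finset.univ.filter fun k : Torus d n => supAbs k ≤ j).card : ℝ)
        ≤ 2 ^ d * ((j : ℝ) + 1) ^ d := by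
      rw [← mul_pow]
      refine (Nat.cast_le.2 (card_supAbs_le j)).trans ?_
      push_cast
      exact pow_le_pow_left₀ (by positivity) (by linarith) d
    have h2 := mul_le_mul h1 (inv_one_add_sq_sub_le j) ?_ (by positivity)
    · refine h2.trans_eq ?_
      ring
    · rw [sub_nonneg]
      exact one_div_le_one_div_of_le (by positivity)
        (by nlinarith [(Nat.cast_nonneg j : (0 : ℝ) ≤ j)])
  · rw [Finset.sum_const, nsmul_eq_mul, mul_one_div]
    simp only [Finset.card_univ, Fintype.card_pi, ZMod.card, Finset.prod_const, Fintype.card_fin,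
      Nat.cast_pow]
    exact div_le_div_of_nonneg_left (by positivity) (by positivity) (by linarith)

/-- Lets bounded terms be absorbed into `g_d(n)`. In `d = 2` it needs `n ≥ 2`, since `log 1 = 0`. -/
theorem one_le_two_mul_green (hdn : d = 2 → 2 ≤ n) : 1 ≤ 2 * green d n := by
  have hn : (1 : ℝ) ≤ n := Nat.one_le_cast.2 (NeZero.pos n)
  unfold green
  split_ifs with h1 h2
  · linarith
  · have h3 : Real.log 2 ≤ Real.log n := Real.log_le_log two_pos (by exact_mod_cast hdn h2)
    linarith [Real.log_two_gt_d9]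
  · norm_num

/-- The sum of `j^{d-3}` up to `n` is bounded for `d = 1`, harmonic for `d = 2`, and at most
`n^{d-2}` for `d ≥ 3`. -/
theorem sum_shell_le (hd : 1 ≤ d) (hdn : d = 2 → 2 ≤ n) :
    ∑ j ∈ Finset.range n, ((j : ℝ) + 1) ^ d / ((j : ℝ) + 1) ^ 3
      ≤ 3 * ((n : ℝ) ^ d * (green d n / (n : ℝ) ^ 2)) := by
  have hn : 0 < (n : ℝ) := Nat.cast_pos.2 (NeZero.pos n)
  have hg := one_le_two_mul_green hdn
  obtain rfl | rfl | hd3 : d = 1 ∨ d = 2 ∨ 3 ≤ d := by omega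
  -- The term `-2/(N+1)` makes the induction work: its increment dominates `1/(N+1)²`.
  · have h : ∀ N : ℕ, ∑ j ∈ Finset.range N, ((j : ℝ) + 1) ^ 1 / ((j : ℝ) + 1) ^ 3
        ≤ 3 - 2 / ((N : ℝ) + 1) := fun N => by
      induction N with
      | zero => norm_num
      | succ N ih =>
        rw [Finset.sum_range_succ]
        have : ((N : ℝ) + 1) ^ 1 / ((N : ℝ) + 1) ^ 3
            ≤ 2 / ((N : ℝ) + 1) - 2 / ((N : ℝ) + 1 + 1) := by
          rw [div_sub_div _ _ (by positivity) (by positivity),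
            div_le_div_iff₀ (by positivity) (by positivity)]
          have := (Nat.cast_nonneg N : (0 : ℝ) ≤ N)
          nlinarith [pow_nonneg this 2, pow_nonneg this 3, pow_nonneg this 4]
        push_cast
        linarith
    have h1 : (n : ℝ) ^ 1 * (green 1 n / (n : ℝ) ^ 2) = 1 := by
      simp only [green, if_true]
      field_simp
    rw [h1]
    have : 0 < 2 / ((n : ℝ) + 1) := by positivity
    linarith [h n]
  · have h1 : (n : ℝ) ^ 2 * (green 2 n / (n : ℝ) ^ 2) = Real.log n := by
      simp only [green]
      norm_num
      field_simp
    have h2 : ∑ j ∈ Finset.range n, ((j : ℝ) + 1) ^ 2 / ((j : ℝ) + 1) ^ 3 = (harmonic n : ℝ) := by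
      rw [harmonic]
      push_cast
      refine Finset.sum_congr rfl fun j _ => ?_
      field_simp
    rw [h1, h2]
    have h3 : green 2 n = Real.log n := by simp [green]
    linarith [harmonic_le_one_add_log n]
  · obtain ⟨e, rfl⟩ := Nat.exists_eq_add_of_le' hd3
    have h1 : green (e + 3) n = 1 := by
      rw [green, if_neg (by omega), if_neg (by omega)]
    rw [h1]
    have h2 : ∀ j ∈ Finset.range n, ((j : ℝ) + 1) ^ (e + 3) / ((j : ℝ) + 1) ^ 3 ≤ (n : ℝ) ^ e := by
      intro j hj
      rw [pow_add, mul_div_cancel_right₀ _ (by positivity)]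
      exact pow_le_pow_left₀ (by positivity) (by exact_mod_cast Finset.mem_range.1 hj) e
    refine (Finset.sum_le_card_nsmul _ _ _ h2).trans ?_
    have h3 : (n : ℝ) ^ (e + 3) * (1 / (n : ℝ) ^ 2) = n * (n : ℝ) ^ e := by
      field_simp
      ring
    rw [h3, Finset.card_range, nsmul_eq_mul]
    have : 0 < (n : ℝ) * (n : ℝ) ^ e := by positivity
    linarith

/-- In the constant, `12 · 2^d` comes from the shells and `2` from the boundary term of the Abel
summation. -/
theorem killedGreen_zero_le (hd : 1 ≤ d) (hdn : d = 2 → 2 ≤ n) :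
    killedGreen (0 : Torus d n) ≤ (12 * 2 ^ d + 2) * (green d n / (n : ℝ) ^ 2) := by
  have hn : 0 < (n : ℝ) := Nat.cast_pos.2 (NeZero.pos n)
  have h1 : ∑ k : Torus d n, mode k 0 / (1 + 2 * (n : ℝ) ^ 2 * symbol k)
      ≤ ∑ k : Torus d n, 1 / (1 + (supAbs k : ℝ) ^ 2) := by
    refine Finset.sum_le_sum fun k _ => ?_
    rw [mode_zero]
    exact one_div_le_one_div_of_le (by positivity) (by linarith [sq_supAbs_le k])
  have h2 := sum_inv_one_add_sq_supAbs_le (d := d) (n := n)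
  have h3 := mul_le_mul_of_nonneg_left (sum_shell_le hd hdn) (by positivity : (0 : ℝ) ≤ 4 * 2 ^ d)
  have h4 : (n : ℝ) ^ d / (n : ℝ) ^ 2 ≤ (n : ℝ) ^ d * (2 * (green d n / (n : ℝ) ^ 2)) := by
    rw [div_eq_mul_one_div ((n : ℝ) ^ d), ← mul_div_assoc 2]
    exact mul_le_mul_of_nonneg_left (div_le_div_of_nonneg_right (one_le_two_mul_green hdn)
      (by positivity)) (by positivity)
  rw [killedGreen, inv_mul_le_iff₀ (by positivity)]
  linarith

end Fourier

end ReactionDiffusion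

end

noncomputable section

namespace ReactionDiffusion

/-! ### Centred products and the action of the generator -/

variable {d n : ℕ}

/-- The product `∏_{x ∈ A} (η_x - ρ)`. -/
def centred (ρ : ℝ) (A : Finset (Torus d n)) (η : Config d n) : ℝ := ∏ x ∈ A, (occ η x - ρ)

theorem abs_occ_sub_le {ρ : ℝ} (hρ : ρ ∈ Set.Icc (0 : ℝ) 1) (η : Config d n) (x : Torus d n) :
    |occ η x - ρ| ≤ 1 := by
  rw [abs_le]
  constructor <;> linarith [occ_nonneg η x, occ_le_one η x, hρ.1, hρ.2]

theorem abs_centred_le {ρ : ℝ} (hρ : ρ ∈ Set.Icc (0 : ℝ) 1) (A : Finset (Torus d n))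
    (η : Config d n) : |centred ρ A η| ≤ 1 := by
  rw [centred, Finset.abs_prod]
  exact Finset.prod_le_one (fun _ _ => abs_nonneg _) fun x _ => abs_occ_sub_le hρ η x

/-- Self-duality of symmetric exclusion: exchanging occupation values amounts to moving the set. -/
theorem centred_exchange (ρ : ℝ) (A : Finset (Torus d n)) (x y : Torus d n) (η : Config d n) :
    centred ρ A (exchange x y η) = centred ρ (A.map (Equiv.swap x y).toEmbedding) η := by
  have h : ∀ z, exchange x y η z = η (Equiv.swap x y z) := fun z => by
    rw [exchange, Equiv.swap_apply_def]
    split_ifs <;> rfl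
  simp [centred, occ, h]

theorem centred_flip_sub (ρ : ℝ) (A : Finset (Torus d n)) (x : Torus d n) (η : Config d n) :
    centred ρ A (flip x η) - centred ρ A η
      = if x ∈ A then (1 - 2 * occ η x) * centred ρ (A.erase x) η else 0 := by
  have hne : ∀ z, z ≠ x → occ (flip x η) z = occ η z := fun z hz => by simp [occ, flip, hz]
  split_ifs with hx
  · unfold centred
    rw [← Finset.mul_prod_erase A _ hx, ← Finset.mul_prod_erase A _ hx,
      Finset.prod_congr rfl fun z hz => by rw [hne z (Finset.ne_of_mem_erase hz)], ← sub_mul]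
    congr 1
    by_cases h : η x <;> simp [occ, flip, h]
    · ring
  · rw [sub_eq_zero]
    exact Finset.prod_congr rfl fun z hz => by rw [hne z fun h => hx (h ▸ hz)]

theorem occ_sub_mul_centred_of_notMem (ρ : ℝ) {A : Finset (Torus d n)} {y : Torus d n} (hy : y ∉ A)
    (η : Config d n) : (occ η y - ρ) * centred ρ A η = centred ρ (insert y A) η := by
  simp [centred, Finset.prod_insert hy]

/-- For `η ∈ {0,1}`, `(η - ρ)² = ρ(1 - ρ) + (1 - 2ρ)(η - ρ)`. -/
theorem occ_sub_mul_centred_of_mem (ρ : ℝ) {A : Finset (Torus d n)} {y : Torus d n} (hy : y ∈ A)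
    (η : Config d n) : (occ η y - ρ) * centred ρ A η
      = ρ * (1 - ρ) * centred ρ (A.erase y) η + (1 - 2 * ρ) * centred ρ A η := by
  unfold centred
  rw [← Finset.mul_prod_erase A _ hy]
  by_cases h : η y <;> simp [occ, h] <;> ring

/-- The product is a combination of correlations of nonempty sets unless `B = {y}`, when the empty
product appears; the indicator pays for it. -/
theorem abs_map_occ_sub_mul_centred_le {E : (Config d n → ℝ) →ₗ[ℝ] ℝ} {ρ V : ℝ}
    (hE : ∀ h : Config d n → ℝ, (∀ η, |h η| ≤ 1) → |E h| ≤ 1) (hρ : ρ ∈ Set.Icc (0 : ℝ) 1)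
    (hV : ∀ A : Finset (Torus d n), A.Nonempty → |E (centred ρ A)| ≤ V)
    (B : Finset (Torus d n)) (y : Torus d n) :
    |E fun η => (occ η y - ρ) * centred ρ B η| ≤ 2 * V + if B = {y} then 1 else 0 := by
  have hV0 : 0 ≤ V := (abs_nonneg _).trans (hV {y} (Finset.singleton_nonempty y))
  split_ifs with hB
  · refine (hE _ fun η => ?_).trans (by linarith)
    rw [abs_mul]
    exact mul_le_one₀ (abs_occ_sub_le hρ η y) (abs_nonneg _) (abs_centred_le hρ B η)
  · by_cases hy : y ∈ B
    · have hne : (B.erase y).Nonempty := by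
        rw [Finset.nonempty_iff_ne_empty, Ne, Finset.erase_eq_empty_iff]
        rintro (rfl | h)
        · exact Finset.notMem_empty y hy
        · exact hB h
      have hfun : (fun η => (occ η y - ρ) * centred ρ B η)
          = (ρ * (1 - ρ)) • centred ρ (B.erase y) + (1 - 2 * ρ) • centred ρ B :=
        funext fun η => occ_sub_mul_centred_of_mem ρ hy η
      rw [hfun, map_add, map_smul, map_smul, smul_eq_mul, smul_eq_mul]
      have h1 : |ρ * (1 - ρ)| ≤ 1 := by
        rw [abs_le]; constructor <;> nlinarith [hρ.1, hρ.2]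
      have h2 : |1 - 2 * ρ| ≤ 1 := by
        rw [abs_le]; constructor <;> linarith [hρ.1, hρ.2]
      have h3 := mul_le_mul h1 (hV _ hne) (abs_nonneg _) zero_le_one
      have h4 := mul_le_mul h2 (hV B ⟨y, hy⟩) (abs_nonneg _) zero_le_one
      rw [← abs_mul] at h3 h4
      linarith [abs_add_le (ρ * (1 - ρ) * E (centred ρ (B.erase y))) ((1 - 2 * ρ) * E (centred ρ B))]
    · have hfun : (fun η => (occ η y - ρ) * centred ρ B η) = centred ρ (insert y B) :=
        funext fun η => occ_sub_mul_centred_of_notMem ρ hy η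
      rw [hfun]
      linarith [hV _ (Finset.insert_nonempty y B)]

variable [NeZero n]

/-- At a stationary density, the drift of `η_x` has no constant term when written in the centred
variables. -/
theorem rate_mul_one_sub_two_mul_occ (hd : 1 ≤ d) (hn : 3 ≤ n) {a b lam ρ : ℝ}
    (hF : reaction a b lam ρ = 0) (x : Torus d n) (η : Config d n) :
    rate a b lam x η * (1 - 2 * occ η x)
      = -(a + b + lam * ρ) * (occ η x - ρ)
        + lam / (2 * d) * ∑ y with Adj x y,
            ((1 - ρ) * (occ η y - ρ) - (occ η x - ρ) * (occ η y - ρ)) := by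
  have hd' : (d : ℝ) ≠ 0 := by positivity
  have hsum : ∑ y with Adj x y, occ η y = ∑ y with Adj x y, (occ η y - ρ) + 2 * d * ρ := by
    rw [Finset.sum_sub_distrib, sum_neighbours_const hn, sub_add_cancel]
  simp only [← sub_mul, ← Finset.mul_sum]
  rw [rate, hsum]
  generalize ∑ y with Adj x y, (occ η y - ρ) = S
  have h1 : lam / (2 * d) * (S + 2 * d * ρ) = lam / (2 * d) * S + lam * ρ := by field_simp
  rw [h1]
  unfold reaction at hF
  -- In either case the two sides differ by a multiple of F(ρ).
  obtain h | h : occ η x = 0 ∨ occ η x = 1 := by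
    unfold occ
    split_ifs <;> simp
  · rw [h]
    linear_combination hF
  · rw [h]
    linear_combination hF

theorem generator_centred (hd : 1 ≤ d) (hn : 3 ≤ n) {a b lam ρ : ℝ}
    (hF : reaction a b lam ρ = 0) (A : Finset (Torus d n)) :
    generator a b lam (centred ρ A)
      = ((n : ℝ) ^ 2 / 2) • (∑ x, ∑ y with Adj x y,
            (centred ρ (A.map (Equiv.swap x y).toEmbedding) - centred ρ A))
        - ((a + b + lam * ρ) * A.card) • centred ρ A
        + (lam / (2 * d)) • ∑ x ∈ A, ∑ y with Adj x y,
            ((1 - ρ) • (fun η => (occ η y - ρ) * centred ρ (A.erase x) η)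
              - fun η => (occ η y - ρ) * centred ρ A η) := by
  funext η
  have hflip : ∑ x, rate a b lam x η * (centred ρ A (flip x η) - centred ρ A η)
      = -((a + b + lam * ρ) * A.card * centred ρ A η)
        + lam / (2 * d) * ∑ x ∈ A, ∑ y with Adj x y,
            ((1 - ρ) * ((occ η y - ρ) * centred ρ (A.erase x) η)
              - (occ η y - ρ) * centred ρ A η) := by
    simp only [centred_flip_sub, mul_ite, mul_zero]
    rw [← Finset.sum_filter, Finset.filter_mem_eq_inter, Finset.univ_inter, Finset.mul_sum]
    have hcard : -((a + b + lam * ρ) * A.card * centred ρ A η)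
        = ∑ x ∈ A, -((a + b + lam * ρ) * centred ρ A η) := by
      rw [Finset.sum_const, nsmul_eq_mul]
      ring
    rw [hcard, ← Finset.sum_add_distrib]
    refine Finset.sum_congr rfl fun x hx => ?_
    have hA : centred ρ A η = (occ η x - ρ) * centred ρ (A.erase x) η :=
      (Finset.mul_prod_erase A (fun z => occ η z - ρ) hx).symm
    rw [← mul_assoc, rate_mul_one_sub_two_mul_occ hd hn hF, hA, add_mul, mul_assoc (lam / (2 * d)),
      Finset.sum_mul]
    congr 1
    · ring
    · congr 1
      exact Finset.sum_congr rfl fun y _ => by ring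
  rw [generator_apply, hflip]
  simp only [Pi.add_apply, Pi.sub_apply, Pi.smul_apply, smul_eq_mul, Finset.sum_apply,
    centred_exchange]
  ring

/-! ### Stationary equations and the maximum principle -/

section Correlations

variable {E : (Config d n → ℝ) →ₗ[ℝ] ℝ} {a b lam ρ V : ℝ}

/-- The stationary equation for the correlation of the sites in `A`: up to the displayed error, the
exclusion part balances the linear relaxation. -/
theorem abs_stationary_equation_le (hd : 1 ≤ d) (hn : 3 ≤ n)
    (hE : ∀ h : Config d n → ℝ, (∀ η, |h η| ≤ 1) → |E h| ≤ 1)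
    (hgen : ∀ h : Config d n → ℝ, E (generator a b lam h) = 0)
    (hρ : IsStationaryDensity a b lam ρ)
    (hV : ∀ A : Finset (Torus d n), A.Nonempty → |E (centred ρ A)| ≤ V)
    (A : Finset (Torus d n)) :
    |(a + b + lam * ρ) * A.card * E (centred ρ A)
        - (n : ℝ) ^ 2 / 2 * ∑ x, ∑ y with Adj x y,
            (E (centred ρ (A.map (Equiv.swap x y).toEmbedding)) - E (centred ρ A))|
      ≤ 4 * |lam| * A.card * V
        + |lam| / (2 * d) * ∑ x ∈ A, ∑ y with Adj x y, if A.erase x = {y} then 1 else 0 := by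
  have hd' : (d : ℝ) ≠ 0 := by positivity
  have h := hgen (centred ρ A)
  rw [generator_centred hd hn hρ.2] at h
  simp only [map_add, map_sub, map_smul, map_sum, smul_eq_mul] at h
  have heq : (a + b + lam * ρ) * A.card * E (centred ρ A)
        - (n : ℝ) ^ 2 / 2 * ∑ x, ∑ y with Adj x y,
            (E (centred ρ (A.map (Equiv.swap x y).toEmbedding)) - E (centred ρ A))
      = lam / (2 * d) * ∑ x ∈ A, ∑ y with Adj x y,
            ((1 - ρ) * (E fun η => (occ η y - ρ) * centred ρ (A.erase x) η)
              - E fun η => (occ η y - ρ) * centred ρ A η) := by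
    linarith
  have hsum : |∑ x ∈ A, ∑ y with Adj x y,
            ((1 - ρ) * (E fun η => (occ η y - ρ) * centred ρ (A.erase x) η)
              - E fun η => (occ η y - ρ) * centred ρ A η)|
      ≤ ∑ x ∈ A, ∑ y with Adj x y, (4 * V + if A.erase x = {y} then 1 else 0) := by
    refine (Finset.abs_sum_le_sum_abs _ _).trans (Finset.sum_le_sum fun x hx => ?_)
    refine (Finset.abs_sum_le_sum_abs _ _).trans (Finset.sum_le_sum fun y hy => ?_)
    have hxy : x ≠ y := (Finset.mem_filter.1 hy).2.ne
    have h1 := abs_map_occ_sub_mul_centred_le hE hρ.1 hV (A.erase x) y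
    have h2 := abs_map_occ_sub_mul_centred_le hE hρ.1 hV A y
    rw [if_neg fun hA : A = {y} => hxy (Finset.mem_singleton.1 (hA ▸ hx))] at h2
    have h3 : |1 - ρ| ≤ 1 := by
      rw [abs_le]; constructor <;> linarith [hρ.1.1, hρ.1.2]
    have h4 := mul_le_of_le_one_left
      (abs_nonneg (E fun η => (occ η y - ρ) * centred ρ (A.erase x) η)) h3
    rw [← abs_mul] at h4
    linarith [abs_sub ((1 - ρ) * E fun η => (occ η y - ρ) * centred ρ (A.erase x) η)
      (E fun η => (occ η y - ρ) * centred ρ A η)]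
  simp only [Finset.sum_add_distrib, sum_neighbours_const hn, Finset.sum_const, nsmul_eq_mul] at hsum
  rw [heq, abs_mul, abs_div, abs_of_nonneg (by positivity : (0 : ℝ) ≤ 2 * d)]
  refine (mul_le_mul_of_nonneg_left hsum (by positivity)).trans_eq ?_
  rw [mul_add]
  congr 1
  field_simp

/-- Correlations of a number of sites other than two are small compared with the largest one. -/
theorem abs_correlation_le_of_card_ne_two (hd : 1 ≤ d) (hn : 3 ≤ n) (hb : 0 < b) (hlam : |lam| ≤ a)
    (hE : ∀ h : Config d n → ℝ, (∀ η, |h η| ≤ 1) → |E h| ≤ 1)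
    (hgen : ∀ h : Config d n → ℝ, E (generator a b lam h) = 0)
    (hρ : IsStationaryDensity a b lam ρ)
    (hV : ∀ A : Finset (Torus d n), A.Nonempty → |E (centred ρ A)| ≤ V)
    {A : Finset (Torus d n)} (hA : A.Nonempty) (hA2 : A.card ≠ 2) :
    |E (centred ρ A)| ≤ 4 / b * |lam| * V := by
  -- Swaps preserve cardinality, so at a maximiser of this size class the exclusion sum has sign
  -- opposite to the correlation and can be dropped.
  obtain ⟨B, hB, hmax⟩ := Finset.exists_max_image
    (Finset.univ.filter fun B : Finset (Torus d n) => B.card = A.card)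
    (fun B => |E (centred ρ B)|) ⟨A, by simp⟩
  have hBc : B.card = A.card := (Finset.mem_filter.1 hB).2
  refine (hmax A (by simp)).trans ?_
  have hind : ∑ x ∈ B, ∑ y with Adj x y, (if B.erase x = {y} then (1 : ℝ) else 0) = 0 := by
    refine Finset.sum_eq_zero fun x hx => Finset.sum_eq_zero fun y _ => if_neg fun h => hA2 ?_
    rw [← hBc, ← Finset.card_erase_add_one hx, h, Finset.card_singleton]
  have heq := abs_stationary_equation_le hd hn hE hgen hρ hV B
  rw [hind, mul_zero, add_zero] at heq
  have hle : ∀ x y : Torus d n,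
      |E (centred ρ (B.map (Equiv.swap x y).toEmbedding))| ≤ |E (centred ρ B)| := fun x y =>
    hmax _ (by simp [hBc])
  -- `a + lam * ρ ≥ 0` because `|lam| ≤ a` and `ρ ∈ [0,1]`.
  have hκ : b ≤ a + b + lam * ρ := by
    nlinarith [neg_le_of_abs_le hlam, hρ.1.1, hρ.1.2, abs_nonneg lam]
  have hk : (0 : ℝ) < B.card := by
    rw [hBc]; exact_mod_cast hA.card_pos
  have key : (a + b + lam * ρ) * B.card * |E (centred ρ B)| ≤ 4 * |lam| * B.card * V := by
    rcases le_total 0 (E (centred ρ B)) with h0 | h0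
    · have hs : ∑ x, ∑ y with Adj x y,
          (E (centred ρ (B.map (Equiv.swap x y).toEmbedding)) - E (centred ρ B)) ≤ 0 :=
        Finset.sum_nonpos fun x _ => Finset.sum_nonpos fun y _ => by
          linarith [le_abs_self (E (centred ρ (B.map (Equiv.swap x y).toEmbedding))), hle x y,
            abs_of_nonneg h0]
      have := mul_nonpos_of_nonneg_of_nonpos (by positivity : 0 ≤ (n : ℝ) ^ 2 / 2) hs
      rw [abs_of_nonneg h0]
      linarith [le_abs_self ((a + b + lam * ρ) * B.card * E (centred ρ B)
        - (n : ℝ) ^ 2 / 2 * ∑ x, ∑ y with Adj x y,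
            (E (centred ρ (B.map (Equiv.swap x y).toEmbedding)) - E (centred ρ B)))]
    · have hs : 0 ≤ ∑ x, ∑ y with Adj x y,
          (E (centred ρ (B.map (Equiv.swap x y).toEmbedding)) - E (centred ρ B)) :=
        Finset.sum_nonneg fun x _ => Finset.sum_nonneg fun y _ => by
          linarith [neg_abs_le (E (centred ρ (B.map (Equiv.swap x y).toEmbedding))), hle x y,
            abs_of_nonpos h0]
      have := mul_nonneg (by positivity : 0 ≤ (n : ℝ) ^ 2 / 2) hs
      rw [abs_of_nonpos h0]
      linarith [neg_abs_le ((a + b + lam * ρ) * B.card * E (centred ρ B)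
        - (n : ℝ) ^ 2 / 2 * ∑ x, ∑ y with Adj x y,
            (E (centred ρ (B.map (Equiv.swap x y).toEmbedding)) - E (centred ρ B)))]
  have hfin : b * |E (centred ρ B)| ≤ 4 * |lam| * V := by
    refine le_of_mul_le_mul_right ?_ hk
    nlinarith [mul_le_mul_of_nonneg_right hκ (mul_nonneg hk.le (abs_nonneg (E (centred ρ B))))]
  rw [div_mul_eq_mul_div, div_mul_eq_mul_div, le_div_iff₀ hb]
  linarith

end Correlations

/-! ### Two-particle exclusion and pair correlations -/

/-- The exclusion dynamics of two particles. -/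
theorem sum_exchange_pair {g : Torus d n → Torus d n → ℝ} (hg : ∀ x y, g x y = g y x)
    {p q : Torus d n} (hpq : p ≠ q) :
    ∑ x, ∑ y with Adj x y, (g (Equiv.swap x y p) (Equiv.swap x y q) - g p q)
      = 2 * (∑ w with Adj p w, (if w = q then 0 else g w q - g p q)
          + ∑ w with Adj q w, (if w = p then 0 else g p w - g p q)) := by
  let t : Torus d n → Torus d n → ℝ := fun x y =>
    (if x = p then (if y = q then 0 else g y q - g p q) else 0)
      + (if x = q then (if y = p then 0 else g p y - g p q) else 0)
  -- Only bonds touching `p` or `q` matter, and the exchange across `{p, q}` itself has no effect as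
  -- `g` is symmetric.
  have hterm : ∀ x y, Adj x y →
      g (Equiv.swap x y p) (Equiv.swap x y q) - g p q = t x y + t y x := by
    intro x y hxy
    have hne := hxy.ne
    have hg' := hg q p
    simp only [t, Equiv.swap_apply_def]
    by_cases h1 : x = p <;> by_cases h2 : x = q <;> by_cases h3 : y = p <;> by_cases h4 : y = q <;>
      simp_all [eq_comm]
  have hsum : ∑ x, ∑ y with Adj x y, t x y
      = ∑ w with Adj p w, (if w = q then 0 else g w q - g p q)
          + ∑ w with Adj q w, (if w = p then 0 else g p w - g p q) := by
    have h1 : ∀ (r : Torus d n) (F : Torus d n → ℝ),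
        ∑ x, ∑ y with Adj x y, (if x = r then F y else 0) = ∑ w with Adj r w, F w := fun r F => by
      rw [Finset.sum_eq_single r]
      · simp
      · intro x _ hx
        simp [hx]
      · simp
    simp only [t, Finset.sum_add_distrib, h1]
  have hswap : ∑ x, ∑ y with Adj x y, t y x = ∑ x, ∑ y with Adj x y, t x y := by
    refine Finset.sum_comm' fun x y => ?_
    simp only [Finset.mem_univ, Finset.mem_filter, true_and, and_true]
    exact ⟨adj_symm, adj_symm⟩
  rw [Finset.sum_congr rfl fun x _ => Finset.sum_congr rfl fun y hy =>
    hterm x y (Finset.mem_filter.1 hy).2]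
  simp only [Finset.sum_add_distrib] at hsum hswap ⊢
  rw [hswap, ← hsum]
  ring

/-- Full Laplacian minus the suppressed jump onto `q`, after which the Green function would have
taken its value at the origin. -/
theorem sum_neighbours_killedGreen (hn : 3 ≤ n) {p q : Torus d n} (hpq : p ≠ q) :
    2 * (n : ℝ) ^ 2 * ∑ w with Adj p w,
        (if w = q then 0 else killedGreen (w - q) - killedGreen (p - q))
      = killedGreen (p - q) - if Adj p q then
          2 * (n : ℝ) ^ 2 * (killedGreen (0 : Torus d n) - killedGreen (p - q)) else 0 := by
  have h1 : ∀ w : Torus d n, (if w = q then 0 else killedGreen (w - q) - killedGreen (p - q))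
      = (killedGreen (w - q) - killedGreen (p - q))
        - if w = q then killedGreen (0 : Torus d n) - killedGreen (p - q) else 0 := fun w => by
    split_ifs with h <;> simp [h]
  have h2 : ∑ w with Adj p w, (killedGreen (w - q) - killedGreen (p - q))
      = ∑ v with Adj (p - q) v, (killedGreen v - killedGreen (p - q)) := by
    rw [sum_neighbours hn, sum_neighbours hn]
    refine Finset.sum_congr rfl fun i _ => ?_
    rw [add_sub_right_comm, sub_right_comm]
  have h3 : ∑ w with Adj p w, (if w = q then killedGreen (0 : Torus d n) - killedGreen (p - q) else 0)
      = if Adj p q then killedGreen (0 : Torus d n) - killedGreen (p - q) else 0 := by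
    rw [Finset.sum_ite_eq']
    simp
  rw [Finset.sum_congr rfl fun w _ => h1 w, Finset.sum_sub_distrib, h2, h3, mul_sub,
    laplacian_killedGreen hn (sub_ne_zero.2 hpq), mul_ite, mul_zero]

/-- The killed Green function is a supersolution for the two-particle exclusion dynamics. -/
theorem exchange_killedGreen_le (hn : 3 ≤ n) {p q : Torus d n} (hpq : p ≠ q) :
    (n : ℝ) ^ 2 / 2 * ∑ x, ∑ y with Adj x y,
        (killedGreen (Equiv.swap x y p - Equiv.swap x y q) - killedGreen (p - q))
      ≤ killedGreen (0 : Torus d n) - if Adj p q then 2 / (1 + 8 * d : ℝ) else 0 := by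
  have hsymm : ∀ x y : Torus d n, killedGreen (x - y) = killedGreen (y - x) := fun x y => by
    rw [← neg_sub, killedGreen_neg]
  have h1 := sum_neighbours_killedGreen hn hpq
  have h2 := sum_neighbours_killedGreen hn hpq.symm
  simp only [hsymm _ p] at h2
  rw [if_congr (⟨adj_symm, adj_symm⟩ : Adj q p ↔ Adj p q) rfl rfl] at h2
  rw [sum_exchange_pair (g := fun x y => killedGreen (x - y)) hsymm hpq]
  have h3 := le_of_abs_le (abs_killedGreen_le (p - q))
  have h4 : (if Adj p q then 2 / (1 + 8 * d : ℝ) else 0) ≤ if Adj p q then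
      2 * (n : ℝ) ^ 2 * (killedGreen (0 : Torus d n) - killedGreen (p - q)) else 0 := by
    split_ifs
    · refine le_trans ?_ (mul_le_mul_of_nonneg_left
        (killedGreen_zero_sub_ge (sub_ne_zero.2 hpq)) (by positivity))
      have : (1 : ℝ) ≤ n := Nat.one_le_cast.2 (NeZero.pos n)
      rw [mul_one_div, div_le_div_iff₀ (by positivity) (by positivity)]
      nlinarith
    · exact le_rfl
  linarith

section Correlations

variable {E : (Config d n → ℝ) →ₗ[ℝ] ℝ} {a b lam ρ V : ℝ}

/-- At a maximiser of `s φ - T G` over distinct pairs, the exclusion part of `s φ` is at most `T`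
times that of `G`, whose negative part on adjacent pairs cancels the source. Returning to `(p, q)`
costs `2 T G(0)`; taking `s = ±1` gives both signs. -/
theorem mul_pair_correlation_le (hd : 1 ≤ d) (hn : 3 ≤ n) (hb : 0 < b) (hlam : |lam| ≤ a)
    (hE : ∀ h : Config d n → ℝ, (∀ η, |h η| ≤ 1) → |E h| ≤ 1)
    (hgen : ∀ h : Config d n → ℝ, E (generator a b lam h) = 0)
    (hρ : IsStationaryDensity a b lam ρ)
    (hV : ∀ A : Finset (Torus d n), A.Nonempty → |E (centred ρ A)| ≤ V)
    {s : ℝ} (hs : |s| = 1) {p q : Torus d n} (hpq : p ≠ q) :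
    s * E (centred ρ {p, q}) ≤ a * (1 + 8 * d) / 2 * (1 / (2 * b) + 2) * killedGreen (0 : Torus d n)
      + 4 / b * |lam| * V := by
  have ha : 0 ≤ a := (abs_nonneg _).trans hlam
  have hd1 : (1 : ℝ) ≤ d := by exact_mod_cast hd
  -- Chosen so that `T * (2 / (1 + 8d)) = a`, which dominates the source `|lam| / d`.
  set T : ℝ := a * (1 + 8 * d) / 2 with hT
  have hT0 : 0 ≤ T := by positivity
  have hV0 : 0 ≤ V := (abs_nonneg _).trans (hV {p} (Finset.singleton_nonempty p))
  have hG0 := killedGreen_zero_nonneg (d := d) (n := n)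
  obtain ⟨⟨x₀, y₀⟩, hmem, hmax⟩ := Finset.exists_max_image
    (Finset.univ.filter fun z : Torus d n × Torus d n => z.1 ≠ z.2)
    (fun z => s * E (centred ρ {z.1, z.2}) - T * killedGreen (z.1 - z.2)) ⟨(p, q), by simpa using hpq⟩
  have hne : x₀ ≠ y₀ := (Finset.mem_filter.1 hmem).2
  have hind : ∑ x ∈ ({x₀, y₀} : Finset (Torus d n)), ∑ y with Adj x y,
      (if ({x₀, y₀} : Finset (Torus d n)).erase x = {y} then (1 : ℝ) else 0)
      = if Adj x₀ y₀ then 2 else 0 := by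
    have e1 : ({x₀, y₀} : Finset (Torus d n)).erase x₀ = {y₀} := by
      rw [Finset.erase_insert (by simpa using hne)]
    have e2 : ({x₀, y₀} : Finset (Torus d n)).erase y₀ = {x₀} := by
      rw [Finset.pair_comm, Finset.erase_insert (by simpa using hne.symm)]
    have hsymm : Adj y₀ x₀ ↔ Adj x₀ y₀ := ⟨adj_symm, adj_symm⟩
    rw [Finset.sum_pair hne, e1, e2]
    simp only [Finset.singleton_inj, Finset.sum_ite_eq, Finset.mem_filter, Finset.mem_univ,
      true_and, hsymm]
    split_ifs <;> norm_num
  have heq := abs_stationary_equation_le hd hn hE hgen hρ hV {x₀, y₀}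
  rw [hind, Finset.card_pair hne] at heq
  simp only [Finset.map_insert, Finset.map_singleton, Equiv.coe_toEmbedding] at heq
  set S := ∑ x, ∑ y with Adj x y,
    (E (centred ρ {Equiv.swap x y x₀, Equiv.swap x y y₀}) - E (centred ρ {x₀, y₀})) with hS
  have hsum : s * S ≤ T * ∑ x, ∑ y with Adj x y,
      (killedGreen (Equiv.swap x y x₀ - Equiv.swap x y y₀) - killedGreen (x₀ - y₀)) := by
    rw [hS, Finset.mul_sum, Finset.mul_sum]
    refine Finset.sum_le_sum fun x _ => ?_
    rw [Finset.mul_sum, Finset.mul_sum]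
    refine Finset.sum_le_sum fun y _ => ?_
    have := hmax (Equiv.swap x y x₀, Equiv.swap x y y₀) (by simpa using hne)
    simp only at this
    linarith
  have hexch := mul_le_mul_of_nonneg_left (exchange_killedGreen_le hn hne) hT0
  have hsource : |lam| / (2 * d) * (if Adj x₀ y₀ then 2 else 0)
      ≤ T * (if Adj x₀ y₀ then 2 / (1 + 8 * d : ℝ) else 0) := by
    split_ifs
    · have h1 : T * (2 / (1 + 8 * d : ℝ)) = a := by rw [hT]; field_simp
      rw [h1, div_mul_eq_mul_div, div_le_iff₀ (by positivity)]
      nlinarith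
    · simp
  have hbound : (a + b + lam * ρ) * 2 * (s * E (centred ρ {x₀, y₀}))
      ≤ T * killedGreen (0 : Torus d n) + 8 * |lam| * V := by
    have h1 : s * ((a + b + lam * ρ) * (2 : ℕ) * E (centred ρ {x₀, y₀}) - (n : ℝ) ^ 2 / 2 * S)
        ≤ 4 * |lam| * (2 : ℕ) * V + |lam| / (2 * d) * (if Adj x₀ y₀ then 2 else 0) := by
      refine (le_abs_self _).trans ?_
      rw [abs_mul, hs, one_mul]
      exact heq
    have h2 := mul_le_mul_of_nonneg_left hsum (by positivity : 0 ≤ (n : ℝ) ^ 2 / 2)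
    push_cast at h1
    linarith
  have hκ : b ≤ a + b + lam * ρ := by
    nlinarith [neg_le_of_abs_le hlam, hρ.1.1, hρ.1.2, abs_nonneg lam]
  have hx : s * E (centred ρ {x₀, y₀})
      ≤ T * (1 / (2 * b)) * killedGreen (0 : Torus d n) + 4 / b * |lam| * V := by
    have hrhs : T * (1 / (2 * b)) * killedGreen (0 : Torus d n) + 4 / b * |lam| * V
        = (T * killedGreen (0 : Torus d n) + 8 * |lam| * V) / (2 * b) := by
      field_simp
      ring
    rw [hrhs, le_div_iff₀ (by positivity)]
    rcases le_total 0 (s * E (centred ρ {x₀, y₀})) with h0 | h0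
    · nlinarith
    · have : 0 ≤ T * killedGreen (0 : Torus d n) + 8 * |lam| * V := by positivity
      nlinarith
  have h1 := hmax (p, q) (by simpa using hpq)
  simp only at h1
  have h2 := mul_le_mul_of_nonneg_left (le_of_abs_le (abs_killedGreen_le (p - q))) hT0
  have h3 := mul_le_mul_of_nonneg_left (neg_le_of_abs_le (abs_killedGreen_le (x₀ - y₀))) hT0
  linarith

/-- For small `lam`, all stationary correlations are of the order of the killed Green function. -/
theorem abs_correlation_le (hd : 1 ≤ d) (hn : 3 ≤ n) (hb : 0 < b) (hlam : |lam| ≤ a)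
    (hlam' : |lam| ≤ b / 8)
    (hE : ∀ h : Config d n → ℝ, (∀ η, |h η| ≤ 1) → |E h| ≤ 1)
    (hgen : ∀ h : Config d n → ℝ, E (generator a b lam h) = 0)
    (hρ : IsStationaryDensity a b lam ρ) {A : Finset (Torus d n)} (hA : A.Nonempty) :
    |E (centred ρ A)| ≤ a * (1 + 8 * d) * (1 / (2 * b) + 2) * killedGreen (0 : Torus d n) := by
  have ha : 0 ≤ a := (abs_nonneg _).trans hlam
  have hG0 := killedGreen_zero_nonneg (d := d) (n := n)
  obtain ⟨B, hB, hmax⟩ := Finset.exists_max_image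
    (Finset.univ.filter fun B : Finset (Torus d n) => B.Nonempty)
    (fun B => |E (centred ρ B)|) ⟨A, by simpa using hA⟩
  have hV : ∀ A : Finset (Torus d n), A.Nonempty → |E (centred ρ A)| ≤ |E (centred ρ B)| :=
    fun A hA => hmax A (by simpa using hA)
  set V := |E (centred ρ B)| with hVdef
  have hV0 : 0 ≤ V := abs_nonneg _
  -- Half of `V` is thus absorbed on the left, doubling the constant of the pair bound.
  have hsmall : 4 / b * |lam| * V ≤ V / 2 := by
    have : 4 / b * |lam| ≤ 1 / 2 := by
      rw [div_mul_eq_mul_div, div_le_iff₀ hb]; linarith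
    nlinarith
  have hC : 0 ≤ a * (1 + 8 * d) / 2 * (1 / (2 * b) + 2) * killedGreen (0 : Torus d n) := by
    positivity
  have hVle : V ≤ a * (1 + 8 * d) / 2 * (1 / (2 * b) + 2) * killedGreen (0 : Torus d n)
      + 4 / b * |lam| * V := by
    by_cases h2 : B.card = 2
    · obtain ⟨p, q, hpq, rfl⟩ := Finset.card_eq_two.1 h2
      rw [hVdef, abs_le']
      have h1 := mul_pair_correlation_le hd hn hb hlam hE hgen hρ hV (s := 1) (by simp) hpq
      have h2 := mul_pair_correlation_le hd hn hb hlam hE hgen hρ hV (s := -1) (by simp) hpq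
      exact ⟨by linarith, by linarith⟩
    · have := abs_correlation_le_of_card_ne_two hd hn hb hlam hE hgen hρ hV
        (Finset.mem_filter.1 hB).2 h2
      linarith
  refine (hV A hA).trans ?_
  linarith

end Correlations

end ReactionDiffusion

end

noncomputable section

namespace ReactionDiffusion

/-! ### Stationary density, second moment and conclusion -/

open MeasureTheory

/-- F(0) = a and F(1) = -b give existence. Between two zeros F(σ) - F(ρ) factors through `σ - ρ`,
with cofactor negative since `|lam| < a`. -/
theorem existsUnique_isStationaryDensity {a b lam : ℝ} (hb : 0 < b) (hlam : |lam| < a) :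
    ∃! ρ : ℝ, IsStationaryDensity a b lam ρ := by
  have ha : 0 < a := (abs_nonneg _).trans_lt hlam
  have hcont : ContinuousOn (reaction a b lam) (Set.Icc 0 1) := by
    unfold reaction
    fun_prop
  obtain ⟨ρ, hρ, hF⟩ := intermediate_value_Icc' zero_le_one hcont
    (show (0 : ℝ) ∈ Set.Icc _ _ by simp [reaction, ha.le, hb.le])
  refine ⟨ρ, ⟨hρ, hF⟩, fun σ ⟨hσ, hσF⟩ => ?_⟩
  unfold reaction at hF hσF
  have hfac : (σ - ρ) * (lam * (1 - ρ - σ) - a - b) = 0 := by linear_combination hσF - hF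
  refine sub_eq_zero.1 ((mul_eq_zero.1 hfac).resolve_right (ne_of_lt ?_))
  have h1 : |1 - ρ - σ| ≤ 1 := by
    rw [abs_le]
    constructor <;> linarith [hρ.1, hρ.2, hσ.1, hσ.2]
  have h2 := mul_le_mul hlam.le h1 (abs_nonneg _) ha.le
  rw [← abs_mul] at h2
  linarith [le_abs_self (lam * (1 - ρ - σ))]

variable {d n : ℕ} [NeZero n]

/-- Expectation with respect to `μ`, as a linear functional. -/
def expectation (μ : Measure (Config d n)) [IsFiniteMeasure μ] : (Config d n → ℝ) →ₗ[ℝ] ℝ where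
  toFun h := ∫ η, h η ∂μ
  map_add' _ _ := integral_add .of_finite .of_finite
  map_smul' c h := integral_const_mul c h

theorem abs_expectation_le_one (μ : Measure (Config d n)) [IsProbabilityMeasure μ]
    {h : Config d n → ℝ} (hh : ∀ η, |h η| ≤ 1) : |expectation μ h| ≤ 1 := by
  have := norm_integral_le_of_norm_le_const (μ := μ) (f := h) (C := 1)
    (ae_of_all μ fun η => (Real.norm_eq_abs _).trans_le (hh η))
  simpa [expectation] using this

/-- A bound on the two-point correlations gives a bound on the second moment of the density field. -/
theorem integral_sq_field_le (μ : Measure (Config d n)) [IsProbabilityMeasure μ] {ρ V : ℝ}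
    (hρ : ρ ∈ Set.Icc (0 : ℝ) 1) (hV0 : 0 ≤ V)
    (hV : ∀ p q : Torus d n, p ≠ q → |expectation μ (centred ρ {p, q})| ≤ V) (f : Torus d n → ℝ) :
    ∫ η, (1 / (n : ℝ) ^ d * ∑ x, (occ η x - ρ) * f x) ^ 2 ∂μ
      ≤ (1 / (n : ℝ) ^ d + V) * (1 / (n : ℝ) ^ d * ∑ x, f x ^ 2) := by
  have hn : 0 < (n : ℝ) ^ d := pow_pos (Nat.cast_pos.2 (NeZero.pos n)) d
  have hexp : (fun η : Config d n => (1 / (n : ℝ) ^ d * ∑ x, (occ η x - ρ) * f x) ^ 2)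
      = (1 / (n : ℝ) ^ d) ^ 2 • ∑ x, ∑ y, (f x * f y) • fun η => (occ η x - ρ) * (occ η y - ρ) := by
    funext η
    simp only [mul_pow, sq (∑ x, (occ η x - ρ) * f x), Finset.sum_mul_sum, Pi.smul_apply,
      Finset.sum_apply, smul_eq_mul]
    congr 1
    exact Finset.sum_congr rfl fun x _ => Finset.sum_congr rfl fun y _ => by ring
  have hterm : ∀ x y : Torus d n, f x * f y * expectation μ (fun η => (occ η x - ρ) * (occ η y - ρ))
      ≤ V * (|f x| * |f y|) + if x = y then f x ^ 2 else 0 := fun x y => by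
    refine (le_abs_self _).trans ?_
    rw [abs_mul, abs_mul]
    split_ifs with h
    · subst h
      have h1 := abs_expectation_le_one μ (h := fun η => (occ η x - ρ) * (occ η x - ρ)) fun η => by
        rw [abs_mul]
        exact mul_le_one₀ (abs_occ_sub_le hρ η x) (abs_nonneg _) (abs_occ_sub_le hρ η x)
      have h2 : |f x| * |f x| = f x ^ 2 := by rw [← sq, sq_abs]
      rw [h2]
      nlinarith [sq_nonneg (f x)]
    · have h1 : (fun η : Config d n => (occ η x - ρ) * (occ η y - ρ)) = centred ρ {x, y} :=
        funext fun η => by rw [centred, Finset.prod_pair h]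
      rw [h1, add_zero, mul_comm V]
      exact mul_le_mul_of_nonneg_left (hV x y h) (by positivity)
  have hcs : (∑ x : Torus d n, |f x|) ^ 2 ≤ (n : ℝ) ^ d * ∑ x, f x ^ 2 := by
    have := sq_sum_le_card_mul_sum_sq (s := Finset.univ) (f := fun x : Torus d n => |f x|)
    simpa [ZMod.card] using this
  have hsum : ∑ x, ∑ y, f x * f y * expectation μ (fun η => (occ η x - ρ) * (occ η y - ρ))
      ≤ V * ((n : ℝ) ^ d * ∑ x, f x ^ 2) + ∑ x, f x ^ 2 := by
    refine (Finset.sum_le_sum fun x _ => Finset.sum_le_sum fun y _ => hterm x y).trans ?_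
    simp only [Finset.sum_add_distrib, Finset.sum_ite_eq, Finset.mem_univ, if_true,
      ← Finset.mul_sum, ← Finset.sum_mul, ← sq]
    linarith [mul_le_mul_of_nonneg_left hcs hV0]
  change expectation μ _ ≤ _
  rw [hexp]
  simp only [map_smul, map_sum, smul_eq_mul]
  refine (mul_le_mul_of_nonneg_left hsum (by positivity)).trans_eq ?_
  field_simp
  ring

/-- Shows that the diagonal contribution is no larger than the target order. -/
theorem one_div_pow_le_green (hd : 1 ≤ d) (hdn : d = 2 → 2 ≤ n) :
    1 / (n : ℝ) ^ d ≤ 2 * (green d n / (n : ℝ) ^ 2) := by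
  have hn : (1 : ℝ) ≤ n := Nat.one_le_cast.2 (NeZero.pos n)
  obtain rfl | hd2 : d = 1 ∨ 2 ≤ d := by omega
  · simp only [green, if_true]
    rw [← mul_div_assoc, div_le_div_iff₀ (by positivity) (by positivity)]
    nlinarith
  · rw [← mul_div_assoc]
    exact div_le_div₀ (by linarith [one_le_two_mul_green hdn]) (one_le_two_mul_green hdn)
      (by positivity) (pow_le_pow_right₀ hn hd2)

end ReactionDiffusion

end

open MeasureTheory ReactionDiffusion in
theorem theorem2p1 (d : ℕ) (hd : 1 ≤ d) (a b : ℝ) (ha : 0 < a) (hb : 0 < b) :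
    ∃ lamc C : ℝ, 0 < lamc ∧ lamc < a ∧
      ∀ (n : ℕ) [NeZero n], (d = 2 → 2 ≤ n) →
      ∀ lam ∈ Set.Icc (-lamc) lamc,
        (∃! ρ : ℝ, IsStationaryDensity a b lam ρ) ∧
        (∃! μ : Measure (Config d n), IsInvariant a b lam μ) ∧
        ∀ (ρ : ℝ) (μ : Measure (Config d n)),
          IsStationaryDensity a b lam ρ → IsInvariant a b lam μ →
          ∀ f : C(Fin d → UnitAddCircle, ℝ),
            ∫ η, (1 / (n : ℝ) ^ d * ∑ x, (occ η x - ρ) * f (scaled x)) ^ 2 ∂μ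
              ≤ C * green d n / (n : ℝ) ^ 2 * (1 / (n : ℝ) ^ d * ∑ x : Torus d n, f (scaled x) ^ 2) := by
  have hK : 0 ≤ a * (1 + 8 * d) * (1 / (2 * b) + 2) := by positivity
  -- `a / 2` keeps the rates positive and `b / 8` allows the absorption of `V`. The `16` covers the
  -- diagonal (`2`) and, when `n ≤ 2`, the trivial bound `V = 1` (`8`).
  refine ⟨min (a / 2) (b / 8), 16 + a * (1 + 8 * d) * (1 / (2 * b) + 2) * (12 * 2 ^ d + 2),
    by positivity, (min_le_left _ _).trans_lt (half_lt_self ha), ?_⟩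
  intro n _ hdn lam hlam
  have hlam' : |lam| ≤ min (a / 2) (b / 8) := abs_le.2 hlam
  have hlama : |lam| < a := (hlam'.trans (min_le_left _ _)).trans_lt (half_lt_self ha)
  have hlamb : |lam| ≤ b / 8 := hlam'.trans (min_le_right _ _)
  refine ⟨existsUnique_isStationaryDensity hb hlama,
    existsUnique_isInvariant a b lam (rate_pos hb hlama), fun ρ μ hρ hμ f => ?_⟩
  obtain ⟨hprob, hgen⟩ := (isInvariant_iff a b lam μ).1 hμ
  have hn1 : (1 : ℝ) ≤ n := Nat.one_le_cast.2 (NeZero.pos n)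
  have hg := one_le_two_mul_green hdn
  have hg0 : 0 ≤ green d n / (n : ℝ) ^ 2 := div_nonneg (by linarith) (by positivity)
  have hpow := one_div_pow_le_green hd hdn
  obtain ⟨V, hV0, hV, hVle⟩ : ∃ V : ℝ, 0 ≤ V ∧
      (∀ p q : Torus d n, p ≠ q → |expectation μ (centred ρ {p, q})| ≤ V) ∧
      1 / (n : ℝ) ^ d + V ≤ (16 + a * (1 + 8 * d) * (1 / (2 * b) + 2) * (12 * 2 ^ d + 2))
        * green d n / (n : ℝ) ^ 2 := by
    rw [mul_div_assoc, add_mul]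
    by_cases hn : 3 ≤ n
    · refine ⟨a * (1 + 8 * d) * (1 / (2 * b) + 2) * killedGreen (0 : Torus d n),
        mul_nonneg hK killedGreen_zero_nonneg, fun p q _ => ?_, ?_⟩
      · exact abs_correlation_le hd hn hb hlama.le hlamb (fun h hh => abs_expectation_le_one μ hh)
          hgen hρ (Finset.insert_nonempty p {q})
      · have := mul_le_mul_of_nonneg_left (killedGreen_zero_le (n := n) hd hdn) hK
        linarith
    · refine ⟨1, zero_le_one, fun p q _ => abs_expectation_le_one μ (abs_centred_le hρ.1 _), ?_⟩
      have hn2 : (n : ℝ) ≤ 2 := by exact_mod_cast (by omega : n ≤ 2)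
      have h1 : 1 ≤ 8 * (green d n / (n : ℝ) ^ 2) := by
        rw [← mul_div_assoc, le_div_iff₀ (by positivity)]
        nlinarith
      have h2 : 0 ≤ a * (1 + 8 * d) * (1 / (2 * b) + 2) * (12 * 2 ^ d + 2)
          * (green d n / (n : ℝ) ^ 2) := by positivity
      linarith
  refine (integral_sq_field_le μ hρ.1 hV0 hV fun x => f (scaled x)).trans ?_
  exact mul_le_mul_of_nonneg_right hVle (by positivity)
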